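/- **Setting.** A system $S=(\Sigma,X,\Gamma,M,A,C)$ consists of a many-sorted signature $\Sigma$, a set $X$ of sorted control variables, a set $\Gamma$ of first-order $\Sigma$-formulae over $X$ closed under semantical consequence in the $\Sigma$-structure $M$, a set $A$ of actions, each $a\in A$ with a set $X^a\subseteq X$ of variables and a transition relation $Tr^a$ on the restrictions to $X^a$ of the states (the assignments $X\to M$ that satisfy $\Gamma$), and a set $C$ of Boolean equations over $A$ closed under deduction. $S$ is a *transition-connected* subsystem of $T$, written $S\hookrightarrow T$, if $\Sigma_S\subseteq\Sigma_T$, $X_S\subseteq X_T$, $A_S\subseteq A_T$, $M_S$ is the reduct of $M_T$ to $\Sigma_S$, the constraints $\Gamma_S$, $C_S$ are consequences of $\Gamma_T$, $C_T$, and ($T_1$) if $a\in A_T$ and $X_T^a\cap X_S\neq\emptyset$ then $a\in A_S$ and $X_S^a=X_T^a\cap X_S$; ($T_2$) if $a\in A_S$ and $s_1,s_2$ are states of $T$ with $(s_1|_{X_T^a},s_2|_{X_T^a})\in Tr_T^a$, then $(s_1|_{X_S^a},s_2|_{X_S^a})\in Tr_S^a$. Let $\mathsf{InSys}$ be a family of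 transition-connected subsystems of one system. The pullback $S_1\wedge S_2$ has signature $\Sigma_1\cap\Sigma_2$, variables $X_1\cap X_2$, constraints $\Gamma_1\cap\Gamma_2$ and $C_1\cap C_2$, actions $A_1\cap A_2$, $X_{12}^a=X_1^a\cap X_2$, and as transitions of $a$ the restrictions to $X_{12}^a$ of the transitions of $a$ between states of $S_1$ or between states of $S_2$. Assume that $\mathsf{InSys}$ is closed under these pullbacks and that they are the meets in $(\mathsf{InSys},\hookrightarrow)$. Assume that for each $S_i\in\mathsf{InSys}$ the constraints $C_{S_i}$ are (the consequences of) equations of the form $a\wedge b=0$ with distinct $a,b\in A_{S_i}$. Let $\Omega(\mathsf{InSys})$ be the topology on $\mathsf{InSys}$ whose open sets are the subsets closed under transition-connected subsystems, and let $S$ be the colimit of $\mathsf{InSys}$ (the union of the systems; in particular $A_S=\bigcup A_{S_i}$, and $C_S$ is the set of consequences of $\bigcup C_{S_i}$ over $A_S$). The dependence graph of a system $T$ is $G_T=(A_T,D_T)$ with $(a,b)\in D_T$ iff $a=b$ or $a\wedge b=0$ belongs to $C_T$, and $M(T)$ is the free partially commutative (trace) monoid $A_T^*/\theta$, where $\theta$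 is the congruence generated by $ab=ba$ for $(a,b)\in (A_T\times A_T)\setminus D_T$. Let $p_i:M(S)\to M(S_i)$ and, for $S_i\hookrightarrow S_j$, $p^j_i:M(S_j)\to M(S_i)$ be the canonical projections, which erase the letters outside $A_{S_i}$. Let $F=\coprod_{S_i\in\mathsf{InSys}}M(S_i)$ with the natural projection $f:F\to\mathsf{InSys}$ and the topology with subbasis the sets $[m](U)=\{p_i(m)\mid S_i\in U\}$, $m\in M(S)$, $U\in\Omega(\mathsf{InSys})$. **Theorem.** $(F,f,\mathsf{InSys})$ is a sheaf space of monoids: $f$ is a local homeomorphism, and the unit and the fibrewise multiplication are continuous. The stalk at $S_i$ of its sheaf of sections is isomorphic to $M(S_i)$, by evaluating germs at $S_i$. The monoid of global sections is $$\Gamma(\mathsf{InSys},F)=\Big\{(m_i)\in\prod_{S_i\in\mathsf{InSys}}M(S_i)\ \Big|\ p^j_i(m_j)=m_i\text{ whenever }S_i\hookrightarrow S_j\Big\}.$$ The assignment $\alpha(m)=(p_i(m))_i$ is a homomorphism $M(S)\to\Gamma(\mathsf{InSys},F)$. 1. If $\mathsf{InSys}$ is finite, then (i) $M(S)\stackrel{\alpha}{\to}\Gamma(\mathsf{InSys},F)\le\prod_i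 M(S_i)$ is a subdirect product: $\alpha$ is injective, and every $\pi_i\circ\alpha:M(S)\to M(S_i)$ is surjective; (ii) $\alpha$ is an isomorphism onto $\Gamma(\mathsf{InSys},F)$ iff every chordless cycle of $G_S$ is a cycle in $G_{S_i}$ for some $S_i\in\mathsf{InSys}$. Here a chordless cycle is a sequence of $n\ge 2$ distinct vertices in which two different vertices are joined by an edge exactly if they are cyclically adjacent. 2. If $\mathsf{InSys}$ is infinite and each $a\in A_S$ belongs to $A_{S_i}$ for at most finitely many $S_i\in\mathsf{InSys}$, then $m\mapsto(p_i(m))_i$ is an injective homomorphism from $M(S)$ into the weak product $\{(w_i)\in\prod_iM(S_i)\mid w_i=\varepsilon\text{ for all but finitely many }i\}$. -/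

import Mathlib

open TopologicalSpace CategoryTheory Opposite Topology

universe u

/-! # Many-sorted first-order logic -/

/-- A many-sorted signature: sorts, operation symbols with arity `s₁ … sₙ → s`, and predicate
symbols with arity `s₁ … sₙ`. -/
structure Signature where
  Srt : Type u
  Op : Type u
  Pred : Type u
  dom : Op → List Srt
  cod : Op → Srt
  arity : Pred → List Srt

namespace Signature

/-- A structure over a many-sorted signature. -/
structure Structure (Sg : Signature.{u}) where
  carrier : Sg.Srt → Type u
  op : ∀ o : Sg.Op, (∀ k : Fin (Sg.dom o).length, carrier ((Sg.dom o).get k)) → carrier (Sg.cod o)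
  pred : ∀ p : Sg.Pred, (∀ k : Fin (Sg.arity p).length, carrier ((Sg.arity p).get k)) → Prop

/-- A signature contained in `Sg`. -/
@[ext]
structure Sub (Sg : Signature.{u}) where
  sorts : Set Sg.Srt
  ops : Set Sg.Op
  preds : Set Sg.Pred
  dom_mem : ∀ o ∈ ops, ∀ s ∈ Sg.dom o, s ∈ sorts
  cod_mem : ∀ o ∈ ops, Sg.cod o ∈ sorts
  arity_mem : ∀ p ∈ preds, ∀ s ∈ Sg.arity p, s ∈ sorts

variable {Sg : Signature.{u}}

/-- Inclusion of signatures. -/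
def Sub.Le (σ τ : Sg.Sub) : Prop :=
  σ.sorts ⊆ τ.sorts ∧ σ.ops ⊆ τ.ops ∧ σ.preds ⊆ τ.preds

/-- Intersection of signatures. -/
def Sub.inter (σ τ : Sg.Sub) : Sg.Sub where
  sorts := σ.sorts ∩ τ.sorts
  ops := σ.ops ∩ τ.ops
  preds := σ.preds ∩ τ.preds
  dom_mem o ho s hs := ⟨σ.dom_mem o ho.1 s hs, τ.dom_mem o ho.2 s hs⟩
  cod_mem o ho := ⟨σ.cod_mem o ho.1, τ.cod_mem o ho.2⟩
  arity_mem p hp s hs := ⟨σ.arity_mem p hp.1 s hs, τ.arity_mem p hp.2 s hs⟩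

/-- Union of a family of signatures. -/
def Sub.iUnion {ι : Type*} (σ : ι → Sg.Sub) : Sg.Sub where
  sorts := ⋃ i, (σ i).sorts
  ops := ⋃ i, (σ i).ops
  preds := ⋃ i, (σ i).preds
  dom_mem o ho s hs := by
    obtain ⟨i, hi⟩ := Set.mem_iUnion.1 ho
    exact Set.mem_iUnion.2 ⟨i, (σ i).dom_mem o hi s hs⟩
  cod_mem o ho := by
    obtain ⟨i, hi⟩ := Set.mem_iUnion.1 ho
    exact Set.mem_iUnion.2 ⟨i, (σ i).cod_mem o hi⟩
  arity_mem p hp s hs := by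
    obtain ⟨i, hi⟩ := Set.mem_iUnion.1 hp
    exact Set.mem_iUnion.2 ⟨i, (σ i).arity_mem p hi s hs⟩

/-- Terms whose free variables lie in a set `X` of sorted variables, and whose bound variables
(de Bruijn indices) are sorted by the list `ctx`. -/
inductive Term (Sg : Signature.{u}) {V : Type u} (vs : V → Sg.Srt) (X : Set V) (ctx : List Sg.Srt) :
    Sg.Srt → Type u
  | var (x : X) : Term Sg vs X ctx (vs x)
  | bvar (k : Fin ctx.length) : Term Sg vs X ctx (ctx.get k)
  | app (o : Sg.Op) (t : ∀ k : Fin (Sg.dom o).length, Term Sg vs X ctx ((Sg.dom o).get k)) :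
      Term Sg vs X ctx (Sg.cod o)

/-- First-order formulae with equality; negation and the other connectives and quantifiers are
expressed through `falsum`, `imp` and `all`. -/
inductive Formula (Sg : Signature.{u}) {V : Type u} (vs : V → Sg.Srt) (X : Set V) :
    List Sg.Srt → Type u
  | falsum {ctx : List Sg.Srt} : Formula Sg vs X ctx
  | eq {ctx : List Sg.Srt} {s : Sg.Srt} (t₁ t₂ : Term Sg vs X ctx s) : Formula Sg vs X ctx
  | rel {ctx : List Sg.Srt} (p : Sg.Pred)
      (t : ∀ k : Fin (Sg.arity p).length, Term Sg vs X ctx ((Sg.arity p).get k)) :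
      Formula Sg vs X ctx
  | imp {ctx : List Sg.Srt} (φ ψ : Formula Sg vs X ctx) : Formula Sg vs X ctx
  | all {ctx : List Sg.Srt} (s : Sg.Srt) (φ : Formula Sg vs X (s :: ctx)) : Formula Sg vs X ctx

/-- The formulae `Fma(X)`: free variables in `X`, no free de Bruijn index. -/
abbrev Fma (Sg : Signature.{u}) {V : Type u} (vs : V → Sg.Srt) (X : Set V) : Type u :=
  Formula Sg vs X []

section

variable {V : Type u} {vs : V → Sg.Srt} {X Y : Set V}

/-- All operation symbols of the term belong to `σ`. -/
def Term.Over (σ : Sg.Sub) {ctx : List Sg.Srt} : {s : Sg.Srt} → Term Sg vs X ctx s → Prop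
  | _, .var _ => True
  | _, .bvar _ => True
  | _, .app o t => o ∈ σ.ops ∧ ∀ k, (t k).Over σ

/-- All symbols and quantified sorts of the formula belong to `σ`. -/
def Formula.Over (σ : Sg.Sub) : {ctx : List Sg.Srt} → Formula Sg vs X ctx → Prop
  | _, .falsum => True
  | _, .eq t₁ t₂ => t₁.Over σ ∧ t₂.Over σ
  | _, .rel p t => p ∈ σ.preds ∧ ∀ k, (t k).Over σ
  | _, .imp φ ψ => φ.Over σ ∧ ψ.Over σ
  | _, .all s φ => s ∈ σ.sorts ∧ φ.Over σ

/-- A term over `X`, regarded as a term over a larger set of variables. -/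
def Term.incl (h : X ⊆ Y) {ctx : List Sg.Srt} :
    {s : Sg.Srt} → Term Sg vs X ctx s → Term Sg vs Y ctx s
  | _, .var x => .var (⟨x.1, h x.2⟩ : Y)
  | _, .bvar k => .bvar k
  | _, .app o t => .app o fun k => (t k).incl h

/-- A formula over `X`, regarded as a formula over a larger set of variables. -/
def Formula.incl (h : X ⊆ Y) : {ctx : List Sg.Srt} → Formula Sg vs X ctx → Formula Sg vs Y ctx
  | _, .falsum => .falsum
  | _, .eq t₁ t₂ => .eq (t₁.incl h) (t₂.incl h)
  | _, .rel p t => .rel p fun k => (t k).incl h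
  | _, .imp φ ψ => .imp (φ.incl h) (ψ.incl h)
  | _, .all s φ => .all s (φ.incl h)

/-- Sort-preserving assignments `s : X → M`. -/
abbrev Assignment (M : Sg.Structure) (vs : V → Sg.Srt) (X : Set V) : Type u :=
  ∀ x : X, M.carrier (vs x)

/-- Restriction of an assignment to a smaller set of variables. -/
def Assignment.res {M : Sg.Structure} (h : X ⊆ Y) (s : Assignment M vs Y) : Assignment M vs X :=
  fun x => s ⟨x.1, h x.2⟩

/-- Value of a term. -/
def Term.eval (M : Sg.Structure) (v : Assignment M vs X) {ctx : List Sg.Srt}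
    (e : ∀ k : Fin ctx.length, M.carrier (ctx.get k)) :
    {s : Sg.Srt} → Term Sg vs X ctx s → M.carrier s
  | _, .var x => v x
  | _, .bvar k => e k
  | _, .app o t => M.op o fun k => (t k).eval M v e

/-- Satisfaction of a formula, relative to values `e` for the de Bruijn indices. -/
def Formula.Realize (M : Sg.Structure) (v : Assignment M vs X) : {ctx : List Sg.Srt} →
    (∀ k : Fin ctx.length, M.carrier (ctx.get k)) → Formula Sg vs X ctx → Prop
  | _, _, .falsum => False
  | _, e, .eq t₁ t₂ => t₁.eval M v e = t₂.eval M v e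
  | _, e, .rel p t => M.pred p fun k => (t k).eval M v e
  | _, e, .imp φ ψ => φ.Realize M v e → ψ.Realize M v e
  | ctx, e, .all s φ => ∀ d : M.carrier s,
      φ.Realize M v (Fin.cons (α := fun k => M.carrier ((s :: ctx).get k)) d e)

/-- `s ⊨ φ`. -/
def Sat (M : Sg.Structure) (v : Assignment M vs X) (φ : Fma Sg vs X) : Prop :=
  φ.Realize M v (ctx := []) (fun k => k.elim0)

/-- The semantical consequence relation `⊨_M`. -/
def Entails (M : Sg.Structure) (Δ : Set (Fma Sg vs X)) (φ : Fma Sg vs X) : Prop :=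
  ∀ v : Assignment M vs X, (∀ γ ∈ Δ, Sat M v γ) → Sat M v φ

theorem Term.eval_incl (M : Sg.Structure) (h : X ⊆ Y) (v : Assignment M vs Y) {ctx : List Sg.Srt}
    (e : ∀ k : Fin ctx.length, M.carrier (ctx.get k)) {s : Sg.Srt} (t : Term Sg vs X ctx s) :
    (t.incl h).eval M v e = t.eval M (v.res h) e := by
  induction t with
  | var x => rfl
  | bvar k => rfl
  | app o t ih => simp only [Term.incl, Term.eval, ih]

theorem Formula.realize_incl (M : Sg.Structure) (h : X ⊆ Y) (v : Assignment M vs Y)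
    {ctx : List Sg.Srt} (φ : Formula Sg vs X ctx)
    (e : ∀ k : Fin ctx.length, M.carrier (ctx.get k)) :
    (φ.incl h).Realize M v e ↔ φ.Realize M (v.res h) e := by
  induction φ with
  | falsum => exact Iff.rfl
  | eq t₁ t₂ => simp only [Formula.incl, Formula.Realize, Term.eval_incl]
  | rel p t => simp only [Formula.incl, Formula.Realize, Term.eval_incl]
  | imp φ ψ ihφ ihψ => simp only [Formula.incl, Formula.Realize, ihφ, ihψ]
  | all s φ ih => simp only [Formula.incl, Formula.Realize, ih]

theorem sat_incl (M : Sg.Structure) (h : X ⊆ Y) (v : Assignment M vs Y) (φ : Fma Sg vs X) :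
    Sat M v (φ.incl h) ↔ Sat M (v.res h) φ :=
  Formula.realize_incl M h v φ _

theorem Term.over_incl {σ τ : Sg.Sub} (hst : σ.Le τ) (h : X ⊆ Y) {ctx : List Sg.Srt} {s : Sg.Srt}
    (t : Term Sg vs X ctx s) (ht : t.Over σ) : (t.incl h).Over τ := by
  induction t with
  | var x => trivial
  | bvar k => trivial
  | app o t ih => exact ⟨hst.2.1 ht.1, fun k => ih k (ht.2 k)⟩

theorem Formula.over_incl {σ τ : Sg.Sub} (hst : σ.Le τ) (h : X ⊆ Y) {ctx : List Sg.Srt}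
    (φ : Formula Sg vs X ctx) (hφ : φ.Over σ) : (φ.incl h).Over τ := by
  induction φ with
  | falsum => trivial
  | eq t₁ t₂ => exact ⟨t₁.over_incl hst h hφ.1, t₂.over_incl hst h hφ.2⟩
  | rel p t => exact ⟨hst.2.2 hφ.1, fun k => (t k).over_incl hst h (hφ.2 k)⟩
  | imp φ ψ ihφ ihψ => exact ⟨ihφ hφ.1, ihψ hφ.2⟩
  | all s φ ih => exact ⟨hst.1 hφ.1, ih hφ.2⟩

end

end Signature

/-! # Boolean equations over actions -/

/-- Boolean terms over `α`, representing the elements of the free Boolean algebra. -/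
inductive BTerm (α : Type u) : Type u
  | var (a : α)
  | bot
  | top
  | neg (t : BTerm α)
  | inf (t₁ t₂ : BTerm α)
  | sup (t₁ t₂ : BTerm α)

namespace BTerm

variable {α : Type u}

/-- The generators that occur in a term. -/
def vars : BTerm α → Set α
  | var a => {a}
  | bot => ∅
  | top => ∅
  | neg t => t.vars
  | inf t₁ t₂ => t₁.vars ∪ t₂.vars
  | sup t₁ t₂ => t₁.vars ∪ t₂.vars

/-- Value of a term under `f : α → {0, 1}`. -/
def eval (f : α → Bool) : BTerm α → Bool
  | var a => f a
  | bot => false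
  | top => true
  | neg t => !(t.eval f)
  | inf t₁ t₂ => t₁.eval f && t₂.eval f
  | sup t₁ t₂ => t₁.eval f || t₂.eval f

end BTerm

/-- A Boolean equation `lhs = rhs`. -/
structure BoolEqn (α : Type u) where
  lhs : BTerm α
  rhs : BTerm α

namespace BoolEqn

variable {α : Type u}

/-- The equation is an equation over `F_B(A)`. -/
def Over (A : Set α) (e : BoolEqn α) : Prop := e.lhs.vars ⊆ A ∧ e.rhs.vars ⊆ A

/-- `f : α → {0, 1}` satisfies the equation. -/
def Holds (f : α → Bool) (e : BoolEqn α) : Prop := e.lhs.eval f = e.rhs.eval f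

/-- The equation `e` can be deduced from `C`; for Boolean equations it suffices to look at
assignments into `{0, 1}`. -/
def Entails (C : Set (BoolEqn α)) (e : BoolEqn α) : Prop := ∀ f : α → Bool, (∀ c ∈ C, c.Holds f) → e.Holds f

/-- The equation `a ∧ b = 0`. -/
def conflict (a b : α) : BoolEqn α := ⟨.inf (.var a) (.var b), .bot⟩

end BoolEqn

/-! # Systems -/

open Signature

/-- A system `(Σ, X, Γ, M|Σ, A, C)`. The symbols of `Σ`, the variables in `X` and the actions in
`A` are taken from `Sg`, `V` and `Act`, and the structure of the system is the reduct to `Σ` of the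
given structure `M`. So all systems of type `System M vs Act` agree on their common symbols, as
all subsystems of one system do. -/
structure System {Sg : Signature.{u}} (M : Sg.Structure) {V : Type u} (vs : V → Sg.Srt)
    (Act : Type u) where
  sig : Sg.Sub
  X : Set V
  X_sort : ∀ x ∈ X, vs x ∈ sig.sorts
  /-- the constraints `Γ` on the variables, closed under semantical consequence -/
  Gam : Set (Fma Sg vs X)
  Gam_over : ∀ φ ∈ Gam, φ.Over sig
  Gam_closed : ∀ φ : Fma Sg vs X, φ.Over sig → Signature.Entails M Gam φ → φ ∈ Gam
  A : Set Act
  /-- the set `X^a` of variables on which the action `a` depends -/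
  dep : A → Set V
  dep_subset : ∀ a, dep a ⊆ X
  /-- the transition relation `Tr^a`, a relation on `St^a = {s|X^a : s ⊨ Γ}` -/
  Tr : ∀ a : A, Assignment M vs (dep a) → Assignment M vs (dep a) → Prop
  Tr_states : ∀ a p q, Tr a p q →
    (∃ s : Assignment M vs X, (∀ γ ∈ Gam, Sat M s γ) ∧ s.res (dep_subset a) = p) ∧
    (∃ s : Assignment M vs X, (∀ γ ∈ Gam, Sat M s γ) ∧ s.res (dep_subset a) = q)
  /-- the constraints on actions, closed under deduction -/
  C : Set (BoolEqn Act)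
  C_over : ∀ e ∈ C, e.Over A
  C_closed : ∀ e : BoolEqn Act, e.Over A → BoolEqn.Entails C e → e ∈ C

namespace System

variable {Sg : Signature.{u}} {M : Sg.Structure} {V : Type u} {vs : V → Sg.Srt} {Act : Type u}

/-- The set of states. -/
def St (S : System M vs Act) : Set (Assignment M vs S.X) := {s | ∀ γ ∈ S.Gam, Sat M s γ}

/-- `S` is a subsystem of `T`. -/
structure IsSubsystem (S T : System M vs Act) : Prop where
  sig_le : S.sig.Le T.sig
  X_subset : S.X ⊆ T.X
  A_subset : S.A ⊆ T.A
  Gam_entails : ∀ γ ∈ S.Gam, Signature.Entails M T.Gam (γ.incl X_subset)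
  C_entails : ∀ e ∈ S.C, BoolEqn.Entails T.C e

/-- `S ↪ T`: `S` is a transition-connected subsystem of `T`. -/
structure IsTC (S T : System M vs Act) : Prop extends IsSubsystem S T where
  dep_eq : ∀ a : T.A, (T.dep a ∩ S.X).Nonempty → ∃ h : a.1 ∈ S.A, S.dep ⟨a.1, h⟩ = T.dep a ∩ S.X
  tr : ∀ a : S.A, ∀ s₁ ∈ T.St, ∀ s₂ ∈ T.St,
    T.Tr ⟨a.1, A_subset a.2⟩ (s₁.res (T.dep_subset _)) (s₂.res (T.dep_subset _)) →
    S.Tr a (s₁.res ((S.dep_subset a).trans X_subset)) (s₂.res ((S.dep_subset a).trans X_subset))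

/-- The pullback `S₁ ∧ S₂`. -/
def pullback (S₁ S₂ : System M vs Act) : System M vs Act where
  sig := S₁.sig.inter S₂.sig
  X := S₁.X ∩ S₂.X
  X_sort x hx := ⟨S₁.X_sort x hx.1, S₂.X_sort x hx.2⟩
  Gam := {φ | φ.Over (S₁.sig.inter S₂.sig) ∧ φ.incl Set.inter_subset_left ∈ S₁.Gam ∧
    φ.incl Set.inter_subset_right ∈ S₂.Gam}
  Gam_over φ hφ := hφ.1
  Gam_closed φ hφ h := by
    refine ⟨hφ, S₁.Gam_closed _ (φ.over_incl ⟨Set.inter_subset_left, Set.inter_subset_left,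
      Set.inter_subset_left⟩ _ hφ) ?_, S₂.Gam_closed _ (φ.over_incl ⟨Set.inter_subset_right,
      Set.inter_subset_right, Set.inter_subset_right⟩ _ hφ) ?_⟩
    · intro v hv
      exact (sat_incl M _ v φ).2 (h _ fun γ hγ => (sat_incl M _ v γ).1 (hv _ hγ.2.1))
    · intro v hv
      exact (sat_incl M _ v φ).2 (h _ fun γ hγ => (sat_incl M _ v γ).1 (hv _ hγ.2.2))
  A := S₁.A ∩ S₂.A
  dep a := S₁.dep ⟨a.1, a.2.1⟩ ∩ S₂.X
  dep_subset a := Set.inter_subset_inter_left _ (S₁.dep_subset _)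
  Tr a p q :=
    (∃ s₁ ∈ S₁.St, ∃ s₂ ∈ S₁.St,
      S₁.Tr ⟨a.1, a.2.1⟩ (s₁.res (S₁.dep_subset _)) (s₂.res (S₁.dep_subset _)) ∧
      s₁.res (Set.inter_subset_left.trans (S₁.dep_subset _)) = p ∧
      s₂.res (Set.inter_subset_left.trans (S₁.dep_subset _)) = q) ∨
    (∃ s₁ ∈ S₂.St, ∃ s₂ ∈ S₂.St,
      S₂.Tr ⟨a.1, a.2.2⟩ (s₁.res (S₂.dep_subset _)) (s₂.res (S₂.dep_subset _)) ∧
      s₁.res Set.inter_subset_right = p ∧ s₂.res Set.inter_subset_right = q)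
  Tr_states a p q h := by
    rcases h with ⟨s₁, h₁, s₂, h₂, -, rfl, rfl⟩ | ⟨s₁, h₁, s₂, h₂, -, rfl, rfl⟩
    · exact ⟨⟨s₁.res Set.inter_subset_left, fun γ hγ => (sat_incl M _ s₁ γ).1 (h₁ _ hγ.2.1), rfl⟩,
        ⟨s₂.res Set.inter_subset_left, fun γ hγ => (sat_incl M _ s₂ γ).1 (h₂ _ hγ.2.1), rfl⟩⟩
    · exact ⟨⟨s₁.res Set.inter_subset_right, fun γ hγ => (sat_incl M _ s₁ γ).1 (h₁ _ hγ.2.2), rfl⟩,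
        ⟨s₂.res Set.inter_subset_right, fun γ hγ => (sat_incl M _ s₂ γ).1 (h₂ _ hγ.2.2), rfl⟩⟩
  C := S₁.C ∩ S₂.C
  C_over e he := ⟨Set.subset_inter (S₁.C_over e he.1).1 (S₂.C_over e he.2).1,
    Set.subset_inter (S₁.C_over e he.1).2 (S₂.C_over e he.2).2⟩
  C_closed e he h :=
    ⟨S₁.C_closed e ⟨he.1.trans Set.inter_subset_left, he.2.trans Set.inter_subset_left⟩
      fun f hf => h f fun c hc => hf c hc.1,
     S₂.C_closed e ⟨he.1.trans Set.inter_subset_right, he.2.trans Set.inter_subset_right⟩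
      fun f hf => h f fun c hc => hf c hc.2⟩

/-- The colimit of a family of transition-connected subsystems of a system. -/
def colimit (I : Set (System M vs Act)) : System M vs Act where
  sig := Sub.iUnion fun i : I => i.1.sig
  X := ⋃ i : I, i.1.X
  X_sort x hx := by
    obtain ⟨i, hi⟩ := Set.mem_iUnion.1 hx
    exact Set.mem_iUnion.2 ⟨i, i.1.X_sort x hi⟩
  Gam := {φ | φ.Over (Sub.iUnion fun i : I => i.1.sig) ∧
    Signature.Entails M
      (⋃ i : I, Formula.incl (Set.subset_iUnion (fun i : I => i.1.X) i) '' i.1.Gam) φ}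
  Gam_over φ hφ := hφ.1
  Gam_closed φ hφ h := ⟨hφ, fun v hv => h v fun _ hγ => hγ.2 v hv⟩
  A := ⋃ i : I, i.1.A
  dep a := ⋃ (i : I) (h : a.1 ∈ i.1.A), i.1.dep ⟨a.1, h⟩
  dep_subset a := Set.iUnion_subset fun i => Set.iUnion_subset fun _ =>
    (i.1.dep_subset _).trans (Set.subset_iUnion (fun i : I => i.1.X) i)
  Tr a p q := ∃ s₁ s₂ : Assignment M vs (⋃ i : I, i.1.X),
    (∀ i : I, s₁.res (Set.subset_iUnion (fun i : I => i.1.X) i) ∈ i.1.St) ∧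
    (∀ i : I, s₂.res (Set.subset_iUnion (fun i : I => i.1.X) i) ∈ i.1.St) ∧
    (∀ (i : I) (h : a.1 ∈ i.1.A), i.1.Tr ⟨a.1, h⟩
      (s₁.res ((i.1.dep_subset _).trans (Set.subset_iUnion (fun i : I => i.1.X) i)))
      (s₂.res ((i.1.dep_subset _).trans (Set.subset_iUnion (fun i : I => i.1.X) i)))) ∧
    s₁.res (Set.iUnion_subset fun i => Set.iUnion_subset fun _ =>
      (i.1.dep_subset _).trans (Set.subset_iUnion (fun i : I => i.1.X) i)) = p ∧
    s₂.res (Set.iUnion_subset fun i => Set.iUnion_subset fun _ =>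
      (i.1.dep_subset _).trans (Set.subset_iUnion (fun i : I => i.1.X) i)) = q
  Tr_states a p q h := by
    obtain ⟨s₁, s₂, h₁, h₂, -, rfl, rfl⟩ := h
    refine ⟨⟨s₁, fun γ hγ => hγ.2 s₁ ?_, rfl⟩, ⟨s₂, fun γ hγ => hγ.2 s₂ ?_, rfl⟩⟩
    · intro δ hδ
      obtain ⟨i, δ', hδ', rfl⟩ := Set.mem_iUnion.1 hδ
      exact (sat_incl M _ s₁ δ').2 (h₁ i δ' hδ')
    · intro δ hδ
      obtain ⟨i, δ', hδ', rfl⟩ := Set.mem_iUnion.1 hδ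
      exact (sat_incl M _ s₂ δ').2 (h₂ i δ' hδ')
  C := {e | e.Over (⋃ i : I, i.1.A) ∧ BoolEqn.Entails (⋃ i : I, i.1.C) e}
  C_over e he := he.1
  C_closed e he h := ⟨he, fun f hf => h f fun _ hc => hc.2 f hf⟩

/-- The constraints on actions are (the consequences of) equations of the form `a ∧ b = 0` with
distinct actions `a`, `b`. -/
def IsExclusive (S : System M vs Act) : Prop :=
  ∃ E : Set (Act × Act), (∀ p ∈ E, p.1 ∈ S.A ∧ p.2 ∈ S.A ∧ p.1 ≠ p.2) ∧
    S.C = {e | e.Over S.A ∧ BoolEqn.Entails ((fun p : Act × Act => BoolEqn.conflict p.1 p.2) '' E) e}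

end System

/-! # Dependence graphs and free partially commutative monoids -/

/-- A dependence graph: a set of vertices with a reflexive and symmetric relation on it. -/
structure DepGraph (Act : Type u) where
  verts : Set Act
  D : Act → Act → Prop
  D_left : ∀ {a b}, D a b → a ∈ verts
  D_symm : ∀ {a b}, D a b → D b a
  D_refl : ∀ {a}, a ∈ verts → D a a

namespace DepGraph

variable {Act : Type u}

/-- `G` is a subgraph of `H`. -/
def IsSub (G H : DepGraph Act) : Prop := G.verts ⊆ H.verts ∧ ∀ a b, G.D a b → H.D a b

/-- The underlying loopless graph. -/
def toSimpleGraph (G : DepGraph Act) : SimpleGraph Act where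
  Adj a b := a ≠ b ∧ G.D a b
  symm := ⟨fun _ _ h => ⟨h.1.symm, G.D_symm h.2⟩⟩
  loopless := ⟨fun _ h => h.1 rfl⟩

/-- Independent letters commute. -/
def commRel (G : DepGraph Act) (v w : FreeMonoid G.verts) : Prop :=
  ∃ a b : G.verts, ¬ G.D a b ∧ v = FreeMonoid.of a * FreeMonoid.of b ∧
    w = FreeMonoid.of b * FreeMonoid.of a

/-- The free partially commutative monoid `M(A, D)`. -/
def TraceMonoid (G : DepGraph Act) : Type u := (conGen G.commRel).Quotient

instance (G : DepGraph Act) : Monoid G.TraceMonoid :=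
  inferInstanceAs (Monoid (conGen G.commRel).Quotient)

/-- The class of a word. -/
def ofWord (G : DepGraph Act) : FreeMonoid G.verts →* G.TraceMonoid := (conGen G.commRel).mk'

open Classical in
/-- The homomorphism that erases the letters which are not vertices of `G`. -/
noncomputable def erase (G H : DepGraph Act) : FreeMonoid H.verts →* G.TraceMonoid :=
  FreeMonoid.lift fun a => if h : a.1 ∈ G.verts then G.ofWord (FreeMonoid.of ⟨a.1, h⟩) else 1

theorem erase_respects {G H : DepGraph Act} (hGH : G.IsSub H) :
    conGen H.commRel ≤ Con.ker (G.erase H) := by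
  refine Con.conGen_le.2 ?_
  rintro _ _ ⟨a, b, hab, rfl, rfl⟩
  rw [Con.ker_rel]
  simp only [map_mul, erase, FreeMonoid.lift_eval_of]
  by_cases ha : a.1 ∈ G.verts
  · by_cases hb : b.1 ∈ G.verts
    · rw [dif_pos ha, dif_pos hb, ← map_mul, ← map_mul]
      refine (Con.eq _).2 (ConGen.Rel.of _ _ ?_)
      exact ⟨⟨a.1, ha⟩, ⟨b.1, hb⟩, fun h => hab (hGH.2 _ _ h), rfl, rfl⟩
    · rw [dif_neg hb, mul_one, one_mul]
  · rw [dif_neg ha, mul_one, one_mul]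

/-- The canonical projection `M(H) → M(G)` for a subgraph `G` of `H`: it maps the letters in `G` to
themselves and erases the others. -/
noncomputable def proj {G H : DepGraph Act} (hGH : G.IsSub H) : H.TraceMonoid →* G.TraceMonoid :=
  (conGen H.commRel).lift (G.erase H) (erase_respects hGH)

/-- A chordless cycle of length `n` in `G`: distinct vertices `c 0, …, c (n - 1)` such that `c k`
and `c l` are joined by an edge exactly if `k` and `l` are cyclically adjacent. -/
abbrev ChordlessCycle (G : DepGraph Act) (n : ℕ) : Type u :=
  {c : SimpleGraph.cycleGraph n ↪g G.toSimpleGraph // ∀ k, c k ∈ G.verts}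

/-- The sequence `c` is a cycle in the graph `G`. -/
def IsCycleIn (G : DepGraph Act) {n : ℕ} (c : Fin n → Act) : Prop :=
  Function.Injective c ∧ (∀ k, c k ∈ G.verts) ∧
    ∀ k l, (SimpleGraph.cycleGraph n).Adj k l → G.toSimpleGraph.Adj (c k) (c l)

end DepGraph

namespace System

variable {Sg : Signature.{u}} {M : Sg.Structure} {V : Type u} {vs : V → Sg.Srt} {Act : Type u}

/-- The dependence graph `(A_S, D_S)` of a system. -/
def depGraph (S : System M vs Act) : DepGraph Act where
  verts := S.A
  D a b := a ∈ S.A ∧ b ∈ S.A ∧ (a = b ∨ BoolEqn.conflict a b ∈ S.C)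
  D_left h := h.1
  D_symm := by
    rintro a b ⟨ha, hb, h | h⟩
    · exact ⟨hb, ha, Or.inl h.symm⟩
    · refine ⟨hb, ha, Or.inr (S.C_closed _ ?_ fun f hf => ?_)⟩
      · have := (S.C_over _ h).1
        exact ⟨Set.union_subset (Set.singleton_subset_iff.2 hb) (Set.singleton_subset_iff.2 ha),
          Set.empty_subset _⟩
      · have := hf _ h
        simp only [BoolEqn.Holds, BoolEqn.conflict, BTerm.eval] at this ⊢
        rw [Bool.and_comm]
        exact this
  D_refl h := ⟨h, h, Or.inl rfl⟩

theorem IsTC.depGraph_isSub {S T : System M vs Act} (h : S.IsTC T) :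
    S.depGraph.IsSub T.depGraph := by
  refine ⟨h.A_subset, ?_⟩
  rintro a b ⟨ha, hb, hab⟩
  refine ⟨h.A_subset ha, h.A_subset hb, hab.imp_right fun hc => ?_⟩
  refine T.C_closed _ ⟨(S.C_over _ hc).1.trans h.A_subset, (S.C_over _ hc).2.trans h.A_subset⟩ ?_
  exact h.C_entails _ hc

theorem depGraph_isSub_colimit {I : Set (System M vs Act)} {S : System M vs Act} (hS : S ∈ I) :
    S.depGraph.IsSub (colimit I).depGraph := by
  have hA : S.A ⊆ ⋃ i : I, i.1.A := Set.subset_iUnion (fun i : I => i.1.A) ⟨S, hS⟩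
  refine ⟨hA, ?_⟩
  rintro a b ⟨ha, hb, hab⟩
  refine ⟨hA ha, hA hb, hab.imp_right fun hc => ?_⟩
  exact ⟨⟨(S.C_over _ hc).1.trans hA, (S.C_over _ hc).2.trans hA⟩,
    fun f hf => hf _ (Set.mem_iUnion.2 ⟨⟨S, hS⟩, hc⟩)⟩

/-- `I` is a family of interacting systems: it consists of transition-connected subsystems of `T`,
it is closed under pullbacks, and these are the meets in `(I, ↪)`. -/
structure IsInteracting (T : System M vs Act) (I : Set (System M vs Act)) : Prop where
  tc : ∀ S ∈ I, S.IsTC T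
  pullback_mem : ∀ S₁ ∈ I, ∀ S₂ ∈ I, S₁.pullback S₂ ∈ I
  pullback_left : ∀ S₁ ∈ I, ∀ S₂ ∈ I, (S₁.pullback S₂).IsTC S₁
  pullback_right : ∀ S₁ ∈ I, ∀ S₂ ∈ I, (S₁.pullback S₂).IsTC S₂
  le_pullback : ∀ S₁ ∈ I, ∀ S₂ ∈ I, ∀ R ∈ I, R.IsTC S₁ → R.IsTC S₂ → R.IsTC (S₁.pullback S₂)

/-- The systems of the family `I`, as the points of a topological space. -/
def Points (I : Set (System M vs Act)) : Type u := {S : System M vs Act // S ∈ I}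

/-- The topology `Ω(I)`: the open sets are the sets closed under transition-connected
subsystems. -/
instance (I : Set (System M vs Act)) : TopologicalSpace (Points I) where
  IsOpen U := ∀ i j : Points I, i.1.IsTC j.1 → j ∈ U → i ∈ U
  isOpen_univ _ _ _ _ := trivial
  isOpen_inter _ _ hU hW i j hij hj := ⟨hU i j hij hj.1, hW i j hij hj.2⟩
  isOpen_sUnion _ h i j hij := fun ⟨U, hU, hj⟩ => ⟨U, hU, h U hU i j hij hj⟩

/-- The free partially commutative monoids `M(Sᵢ)` of the members of the family. -/
abbrev Traces (I : Set (System M vs Act)) (i : Points I) : Type u := i.1.depGraph.TraceMonoid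

/-- `pⱼⁱ : M(Sⱼ) → M(Sᵢ)` for `Sᵢ ↪ Sⱼ`. -/
noncomputable def restr {I : Set (System M vs Act)} {i j : Points I} (h : i.1.IsTC j.1) :
    Traces I j →* Traces I i :=
  DepGraph.proj h.depGraph_isSub

/-- `pᵢ : M(S) → M(Sᵢ)`, where `S` is the colimit of the family. -/
noncomputable def projTo {I : Set (System M vs Act)} (i : Points I) :
    (colimit I).depGraph.TraceMonoid →* Traces I i :=
  DepGraph.proj (depGraph_isSub_colimit i.2)

/-- The set `[m](U) = {pᵢ(m) : Sᵢ ∈ U}` in the disjoint union of the `M(Sᵢ)`. -/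
def basicSet {I : Set (System M vs Act)} (m : (colimit I).depGraph.TraceMonoid)
    (U : Set (Points I)) : Set (Σ i : Points I, Traces I i) :=
  {x | x.1 ∈ U ∧ x.2 = projTo x.1 m}

/-- The topology on `F = ∐ M(Sᵢ)` with subbasis the sets `[m](U)`, `U` open. -/
instance bundleTopology (I : Set (System M vs Act)) :
    TopologicalSpace (Σ i : Points I, Traces I i) :=
  TopologicalSpace.generateFrom {W | ∃ m, ∃ U : Set (Points I), IsOpen U ∧ W = basicSet m U}

end System

/-! # Sheaf spaces of monoids -/

section SheafSpace

variable {B : Type u} [TopologicalSpace B] (E : B → Type u) [∀ b, Monoid (E b)]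
  [τ : TopologicalSpace (Σ b, E b)]

/-- The topology on the fibre product of the bundle `Σ b, E b` with itself: the subspace topology
from the product. -/
@[reducible] def fibreProductTopology : TopologicalSpace (Σ b, E b × E b) :=
  TopologicalSpace.induced
    (fun q => ((⟨q.1, q.2.1⟩, ⟨q.1, q.2.2⟩) : (Σ b, E b) × (Σ b, E b))) inferInstance

/-- The bundle with fibres `E b` is a sheaf space of monoids: the projection is a local
homeomorphism and the operations of the fibres are continuous. -/
structure IsSheafSpaceOfMonoids : Prop where
  isLocalHomeomorph : IsLocalHomeomorph (Sigma.fst : (Σ b, E b) → B)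
  continuous_one : Continuous (fun b => ⟨b, 1⟩ : B → Σ b, E b)
  continuous_mul : Continuous[fibreProductTopology E, τ]
    (fun q => ⟨q.1, q.2.1 * q.2.2⟩ : (Σ b, E b × E b) → Σ b, E b)

variable {E}

/-- The monoid of global sections, as a submonoid of the product of the fibres. -/
def globalSections (h : IsSheafSpaceOfMonoids E) : Submonoid (∀ b, E b) where
  carrier := {s | Continuous (fun b => ⟨b, s b⟩ : B → Σ b, E b)}
  one_mem' := h.continuous_one
  mul_mem' {s t} hs ht := by
    let _ := fibreProductTopology E
    have hq : Continuous (fun b => ⟨b, (s b, t b)⟩ : B → Σ b, E b × E b) :=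
      continuous_induced_rng.2 (Continuous.prodMk hs ht)
    exact h.continuous_mul.comp hq

/-- The monoid of sections over an open set. -/
def sectionsOver (h : IsSheafSpaceOfMonoids E) (U : Opens B) : Submonoid (∀ b : U, E b) where
  carrier := {s | Continuous (fun b => ⟨b, s b⟩ : U → Σ b, E b)}
  one_mem' := h.continuous_one.comp continuous_subtype_val
  mul_mem' {s t} hs ht := by
    let _ := fibreProductTopology E
    have hq : Continuous (fun b => ⟨b, (s b, t b)⟩ : U → Σ b, E b × E b) :=
      continuous_induced_rng.2 (Continuous.prodMk hs ht)
    exact h.continuous_mul.comp hq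

/-- The presheaf of monoids of sections. -/
def sectionsPresheaf (h : IsSheafSpaceOfMonoids E) : TopCat.Presheaf MonCat.{u} (TopCat.of B) where
  obj U := MonCat.of (sectionsOver h U.unop)
  map {U _} f := MonCat.ofHom
    { toFun := fun s => ⟨fun b => s.1 ⟨b.1, f.unop.le b.2⟩,
        Continuous.comp (g := (fun b => ⟨b, s.1 b⟩ : U.unop → Σ b, E b)) s.2
          (continuous_subtype_val.subtype_mk fun b => f.unop.le b.2)⟩
      map_one' := rfl
      map_mul' := fun _ _ => rfl }
  map_id _ := rfl
  map_comp _ _ := rfl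

end SheafSpace

/-- The weak product: the families which are trivial at all but finitely many indices. -/
def weakProduct {ι : Type*} (N : ι → Type*) [∀ i, Monoid (N i)] : Submonoid (∀ i, N i) where
  carrier := {w | {i | w i ≠ 1}.Finite}
  one_mem' := by simp
  mul_mem' {v w} hv hw := (hv.union hw).subset fun i hi => by
    by_contra hc
    simp only [Set.mem_union, Set.mem_ofPred_eq, not_or, not_not] at hc
    exact hi (by simp [hc.1, hc.2])

/-!
The set of restrictions of a trace `y ∈ M(Sⱼ)` to the subsystems of `Sⱼ` is its smallest
neighbourhood in `∐ M(Sᵢ)`: every `y` is of the form `pⱼ(m)`, and the basic sets `[m](U)` are closed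
under restriction (`System.isOpen_traces_iff`). So the projection, which maps this neighbourhood
bijectively onto the smallest neighbourhood of `Sⱼ`, is a local homeomorphism, a section is
continuous exactly if it is compatible with restriction (`System.continuous_section_iff`), and a
germ at `Sⱼ` is determined by its value there.

Everything about traces rests on the fact that a trace is determined by its projections to the words
on pairs of dependent letters (`DepGraph.ext_pairProj`). Two letters are dependent in the colimit
exactly if they are so in some member, because the constraints are conflicts
(`System.exists_D_of_D_colimit`); so a trace of the colimit is determined by its projections to the
members, and `α` is injective. Only finitely many of these projections are nontrivial if each action
occurs in finitely many members.

For surjectivity of `α`, a compatible family is reduced letter by letter. By closure under pullbacks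
its members agree on pairs that are dependent in several of them. If some letter comes first in all
members that contain it, it can be split off (`DepGraph.exists_eq_of_mul`). Otherwise every letter is
blocked by a dependent one, and a shortest cycle of the blocking relation is chordless, since of two
dependent letters one blocks the other. The cycle would lie in some member, where the first of its
letters to occur cannot be blocked by another one (`System.Compatible.exists_leading_letter`).
Conversely, if a chordless cycle lies in no member, then each member misses one of its edges, and the words that run
around the cycle once, starting after a missing edge, induce a compatible family of traces. It does
not come from a global trace, in which each vertex would have to precede its successor
(`System.exists_isCycleIn_of_forall_exists`).
-/

/-! ### Traces are determined by their projections to pairs of dependent letters -/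

namespace DepGraph

variable {Act : Type u} {G H K : DepGraph Act} {a b : Act}

theorem D_right (h : G.D a b) : b ∈ G.verts := G.D_left (G.D_symm h)

theorem ofWord_surjective : Function.Surjective G.ofWord := Con.mk'_surjective

open Classical in
/-- The homomorphism that keeps the letters `a` and `b` of a word and erases all others. -/
noncomputable def pairWord (G : DepGraph Act) (a b : Act) : FreeMonoid G.verts →* FreeMonoid Act :=
  FreeMonoid.lift fun x => if x.1 = a ∨ x.1 = b then FreeMonoid.of x.1 else 1

open Classical in
theorem toList_pairWord (w : FreeMonoid G.verts) :
    (G.pairWord a b w).toList = (w.toList.map Subtype.val).filter fun x => x = a ∨ x = b := by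
  induction w using FreeMonoid.inductionOn' with
  | one => simp
  | of_mul x w ih =>
    rw [map_mul, FreeMonoid.toList_mul, ih]
    simp only [pairWord, FreeMonoid.lift_eval_of, FreeMonoid.toList_of_mul, List.map_cons,
      List.filter_cons]
    split_ifs <;> simp_all

theorem pairWord_respects (hab : G.D a b) : conGen G.commRel ≤ Con.ker (G.pairWord a b) := by
  refine Con.conGen_le.2 ?_
  rintro _ _ ⟨x, y, hxy, rfl, rfl⟩
  rw [Con.ker_rel]
  simp only [map_mul, pairWord, FreeMonoid.lift_eval_of]
  by_cases hx : x.1 = a ∨ x.1 = b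
  · by_cases hy : y.1 = a ∨ y.1 = b
    · refine absurd ?_ hxy
      rcases hx with hx | hx <;> rcases hy with hy | hy <;> rw [hx, hy]
      exacts [G.D_refl (G.D_left hab), hab, G.D_symm hab, G.D_refl (D_right hab)]
    · rw [if_neg hy, mul_one, one_mul]
  · rw [if_neg hx, mul_one, one_mul]

/-- The projection of a trace to the word of its letters `a` and `b`; it is well defined because
`a` and `b` are dependent. For `a = b` it records the number of occurrences of `a`. -/
noncomputable def pairProj (hab : G.D a b) : G.TraceMonoid →* FreeMonoid Act :=
  (conGen G.commRel).lift (G.pairWord a b) (pairWord_respects hab)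

@[simp]
theorem pairProj_ofWord (hab : G.D a b) (w : FreeMonoid G.verts) :
    pairProj hab (G.ofWord w) = G.pairWord a b w := rfl

@[simp]
theorem proj_ofWord (h : G.IsSub H) (w : FreeMonoid H.verts) :
    proj h (H.ofWord w) = G.erase H w := rfl

theorem erase_of_mem {x : H.verts} (hx : x.1 ∈ G.verts) :
    G.erase H (FreeMonoid.of x) = G.ofWord (FreeMonoid.of ⟨x.1, hx⟩) := by
  simp only [erase, FreeMonoid.lift_eval_of, dif_pos hx]

theorem erase_of_notMem {x : H.verts} (hx : x.1 ∉ G.verts) :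
    G.erase H (FreeMonoid.of x) = 1 := by
  simp only [erase, FreeMonoid.lift_eval_of, dif_neg hx]

theorem hom_ext {N : Type*} [Monoid N] {f g : G.TraceMonoid →* N}
    (h : ∀ x, f (G.ofWord (FreeMonoid.of x)) = g (G.ofWord (FreeMonoid.of x))) : f = g := by
  have : f.comp G.ofWord = g.comp G.ofWord := FreeMonoid.hom_eq h
  ext x
  obtain ⟨w, rfl⟩ := ofWord_surjective x
  exact DFunLike.congr_fun this w

theorem proj_proj (hGH : G.IsSub H) (hHK : H.IsSub K) (hGK : G.IsSub K) (x : K.TraceMonoid) :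
    proj hGH (proj hHK x) = proj hGK x := by
  refine DFunLike.congr_fun (f := (proj hGH).comp (proj hHK)) (hom_ext fun y => ?_) x
  simp only [MonoidHom.comp_apply, proj_ofWord]
  by_cases hH : y.1 ∈ H.verts
  · rw [erase_of_mem hH, proj_ofWord]
    by_cases hG : y.1 ∈ G.verts
    · rw [erase_of_mem (x := ⟨y.1, hH⟩) hG, erase_of_mem hG]
    · rw [erase_of_notMem (x := ⟨y.1, hH⟩) hG, erase_of_notMem hG]
  · rw [erase_of_notMem hH, erase_of_notMem fun h => hH (hGH.1 h), map_one]

theorem proj_surjective (h : G.IsSub H) : Function.Surjective (proj h) := by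
  intro x
  obtain ⟨w, rfl⟩ := ofWord_surjective x
  induction w using FreeMonoid.inductionOn' with
  | one => exact ⟨1, by simp⟩
  | of_mul a w ih =>
    obtain ⟨y, hy⟩ := ih
    refine ⟨H.ofWord (FreeMonoid.of ⟨a.1, h.1 a.2⟩) * y, ?_⟩
    rw [map_mul, hy, proj_ofWord, erase_of_mem (x := ⟨a.1, h.1 a.2⟩) a.2, map_mul]

theorem pairProj_proj (h : G.IsSub H) (hab : G.D a b) (x : H.TraceMonoid) :
    pairProj hab (proj h x) = pairProj (h.2 _ _ hab) x := by
  refine DFunLike.congr_fun (f := (pairProj hab).comp (proj h)) (hom_ext fun y => ?_) x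
  simp only [MonoidHom.comp_apply, proj_ofWord, pairProj_ofWord]
  by_cases hy : y.1 ∈ G.verts
  · rw [erase_of_mem hy, pairProj_ofWord]
    simp only [pairWord, FreeMonoid.lift_eval_of]
  · rw [erase_of_notMem hy, map_one]
    simp only [pairWord, FreeMonoid.lift_eval_of]
    rw [if_neg]
    rintro (h | h) <;> rw [h] at hy
    exacts [hy (G.D_left hab), hy (D_right hab)]

theorem ofWord_mul_comm {a : G.verts} {s : List G.verts} (h : ∀ c ∈ s, ¬ G.D a c) :
    G.ofWord (FreeMonoid.ofList s) * G.ofWord (FreeMonoid.of a) =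
      G.ofWord (FreeMonoid.of a) * G.ofWord (FreeMonoid.ofList s) := by
  induction s with
  | nil => simp
  | cons c s ih =>
    have hc : G.ofWord (FreeMonoid.of c) * G.ofWord (FreeMonoid.of a) =
        G.ofWord (FreeMonoid.of a) * G.ofWord (FreeMonoid.of c) := by
      rw [← map_mul, ← map_mul]
      exact (Con.eq _).2 (ConGen.Rel.of _ _
        ⟨c, a, fun hca => h c (by simp) (G.D_symm hca), rfl, rfl⟩)
    rw [FreeMonoid.ofList_cons, map_mul, mul_assoc, ih fun d hd => h d (by simp [hd]),
      ← mul_assoc, hc, mul_assoc]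

/-- If `a` is the first letter of all projections of `x` to pairs `a, b`, then all letters that
precede `a` in a word for `x` are independent of `a`, and so `a` can be moved to the front. -/
theorem exists_eq_of_mul {a : G.verts} {x : G.TraceMonoid}
    (h : ∀ b (hab : G.D a b), (pairProj hab x).toList.head? = some a.1) :
    ∃ y, x = G.ofWord (FreeMonoid.of a) * y := by
  classical
  obtain ⟨w, rfl⟩ := ofWord_surjective x
  simp only [pairProj_ofWord, toList_pairWord] at h
  have hw : a ∈ w.toList := by
    have := List.mem_of_mem_head? (h a (G.D_refl a.2))
    simpa using this
  obtain ⟨s, t, hst, has⟩ := List.eq_append_cons_of_mem hw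
  -- If `c ∈ s` were dependent on `a`, the projection to `a, c` would start with `c`.
  have hs : ∀ c ∈ s, ¬ G.D a c := by
    intro c hc hac
    have := h c hac
    rw [hst, List.map_append, List.filter_append, List.head?_append] at this
    have hne : ((s.map Subtype.val).filter fun x => x = a.1 ∨ x = c.1) ≠ [] := by
      intro h0
      have := List.filter_eq_nil_iff.1 h0 c.1 (List.mem_map_of_mem hc)
      simp at this
    rw [List.head?_eq_some_head hne, Option.some_or] at this
    have hmem := List.mem_of_mem_head? (l := (s.map Subtype.val).filter _)
      ((List.head?_eq_some_head hne).trans this)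
    simp only [List.mem_filter, List.mem_map, Subtype.exists, exists_and_right,
      exists_eq_right] at hmem
    obtain ⟨⟨_, h1⟩, -⟩ := hmem
    exact has h1
  refine ⟨G.ofWord (FreeMonoid.ofList s) * G.ofWord (FreeMonoid.ofList t), ?_⟩
  have : w = FreeMonoid.ofList s * (FreeMonoid.of a * FreeMonoid.ofList t) := by
    rw [← FreeMonoid.ofList_cons, ← FreeMonoid.ofList_append, ← hst, FreeMonoid.ofList_toList]
  rw [this, map_mul, map_mul, ← mul_assoc, ofWord_mul_comm hs, mul_assoc]

theorem pairProj_of_mul_head? {a : G.verts} (hab : G.D a b) (x : G.TraceMonoid) :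
    (pairProj hab (G.ofWord (FreeMonoid.of a) * x)).toList.head? = some a.1 := by
  rw [map_mul, pairProj_ofWord, FreeMonoid.toList_mul]
  simp [pairWord]

/-- A letter that occurs in a word occurs in the corresponding projections. -/
theorem mem_pairProj {a : G.verts} {w : FreeMonoid G.verts} (hab : G.D a b) :
    a.1 ∈ (pairProj hab (G.ofWord w)).toList ↔ a ∈ w.toList := by
  classical
  rw [pairProj_ofWord, toList_pairWord]
  simp

/-- The projections to pairs of dependent letters separate traces. -/
theorem ext_pairProj {x y : G.TraceMonoid}
    (h : ∀ a b (hab : G.D a b), pairProj hab x = pairProj hab y) : x = y := by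
  obtain ⟨v, rfl⟩ := ofWord_surjective x
  induction v using FreeMonoid.inductionOn' generalizing y with
  | one =>
    obtain ⟨w, rfl⟩ := ofWord_surjective y
    have : w.toList = [] := by
      refine List.eq_nil_iff_forall_not_mem.2 fun a ha => ?_
      have := (mem_pairProj (G.D_refl a.2)).2 ha
      rw [← h] at this
      simp at this
    rw [show w = 1 from this]
  | of_mul a v ih =>
    rw [map_mul] at h ⊢
    obtain ⟨z, rfl⟩ := exists_eq_of_mul (x := y) (a := a) fun b hab => by
      rw [← h]
      exact pairProj_of_mul_head? hab _
    rw [ih fun b c hbc => ?_]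
    have := h b c hbc
    rw [map_mul, map_mul] at this
    exact mul_left_cancel this

theorem trace_mul_left_cancel {x y z : G.TraceMonoid} (h : x * y = x * z) : y = z := by
  refine ext_pairProj fun a b hab => ?_
  have := congrArg (pairProj hab) h
  rw [map_mul, map_mul] at this
  exact mul_left_cancel this

/-- The first letter of a word among the vertices of a cycle is the first letter of the projection
to any pair of vertices that contains it. So it cannot be that in each such projection the
successor comes first. -/
theorem not_forall_head? {ι : Type*} [Nonempty ι] (c : ι → Act) (f : ι → ι)
    (hc : ∀ k, c (f k) ≠ c k) (hD : ∀ k, G.D (c k) (c (f k))) (x : G.TraceMonoid) :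
    ¬ ∀ k, (pairProj (hD k) x).toList.head? = some (c (f k)) := by
  classical
  obtain ⟨w, rfl⟩ := ofWord_surjective x
  simp only [pairProj_ofWord, toList_pairWord]
  induction w.toList.map Subtype.val with
  | nil => exact fun h => by simpa using h (Classical.arbitrary ι)
  | cons x l ih =>
    intro h
    by_cases hx : ∃ k, c k = x
    · obtain ⟨k, rfl⟩ := hx
      have := h k
      simp only [List.filter_cons, true_or, decide_true, if_true, List.head?_cons,
        Option.some.injEq] at this
      exact hc k this.symm
    · push Not at hx
      refine ih fun k => ?_
      rw [← h k, List.filter_cons_of_neg]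
      simp [(hx k).symm, (hx (f k)).symm]

/-- The length of a trace. -/
noncomputable def traceLength (G : DepGraph Act) : G.TraceMonoid →* Multiplicative ℕ :=
  (conGen G.commRel).lift (FreeMonoid.lift fun _ => Multiplicative.ofAdd 1) <| by
    refine Con.conGen_le.2 ?_
    rintro _ _ ⟨a, b, -, rfl, rfl⟩
    simp [Con.ker_rel]

end DepGraph

/-! ### Dependence graphs of pullbacks and colimits -/

namespace System

variable {Sg : Signature.{u}} {M : Sg.Structure} {V : Type u} {vs : V → Sg.Srt} {Act : Type u}

theorem IsTC.refl (S : System M vs Act) : S.IsTC S where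
  sig_le := ⟨subset_rfl, subset_rfl, subset_rfl⟩
  X_subset := subset_rfl
  A_subset := subset_rfl
  Gam_entails γ hγ v hv := (sat_incl M _ v γ).2 (hv γ hγ)
  C_entails e he _ hf := hf e he
  dep_eq a _ := ⟨a.2, (Set.inter_eq_left.2 (S.dep_subset a)).symm⟩
  tr _ _ _ _ _ h := h

theorem IsSubsystem.res_mem_St {S T : System M vs Act} (h : S.IsSubsystem T)
    {s : Assignment M vs T.X} (hs : s ∈ T.St) : s.res h.X_subset ∈ S.St :=
  fun γ hγ => (sat_incl M _ s γ).1 (h.Gam_entails γ hγ s hs)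

theorem IsTC.trans {R S T : System M vs Act} (h : R.IsTC S) (h' : S.IsTC T) : R.IsTC T where
  sig_le := ⟨h.sig_le.1.trans h'.sig_le.1, h.sig_le.2.1.trans h'.sig_le.2.1,
    h.sig_le.2.2.trans h'.sig_le.2.2⟩
  X_subset := h.X_subset.trans h'.X_subset
  A_subset := h.A_subset.trans h'.A_subset
  Gam_entails γ hγ v hv := by
    refine (sat_incl M _ v γ).2 ?_
    exact (sat_incl M h.X_subset (v.res h'.X_subset) γ).1
      (h.Gam_entails γ hγ _ (h'.toIsSubsystem.res_mem_St hv))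
  C_entails e he f hf := h.C_entails e he f fun c hc => h'.C_entails c hc f hf
  dep_eq a ha := by
    obtain ⟨x, hx, hxR⟩ := ha
    obtain ⟨haS, hS⟩ := h'.dep_eq a ⟨x, hx, h.X_subset hxR⟩
    have hxS : x ∈ S.dep ⟨a.1, haS⟩ := hS ▸ ⟨hx, h.X_subset hxR⟩
    obtain ⟨haR, hR⟩ := h.dep_eq ⟨a.1, haS⟩ ⟨x, hxS, hxR⟩
    refine ⟨haR, ?_⟩
    rw [hR, hS, Set.inter_assoc, Set.inter_eq_right.2 h.X_subset]
  tr a s₁ h₁ s₂ h₂ hst :=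
    h.tr a (s₁.res h'.X_subset) (h'.toIsSubsystem.res_mem_St h₁) (s₂.res h'.X_subset)
      (h'.toIsSubsystem.res_mem_St h₂) (h'.tr ⟨a.1, h.A_subset a.2⟩ s₁ h₁ s₂ h₂ hst)

theorem D_pullback {S₁ S₂ : System M vs Act} {a b : Act} (h₁ : S₁.depGraph.D a b)
    (h₂ : S₂.depGraph.D a b) : (S₁.pullback S₂).depGraph.D a b := by
  obtain ⟨ha₁, hb₁, h₁⟩ := h₁
  obtain ⟨ha₂, hb₂, h₂⟩ := h₂
  refine ⟨⟨ha₁, ha₂⟩, ⟨hb₁, hb₂⟩, ?_⟩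
  rcases h₁ with h₁ | h₁
  · exact Or.inl h₁
  · exact h₂.imp_right fun h₂ => ⟨h₁, h₂⟩

variable {I : Set (System M vs Act)}

/-- The assignment with value `1` at `a` and `b` only satisfies all equations `c ∧ d = 0` except
those with `{c, d} = {a, b}`. So the conflicts in the colimit are the conflicts of its members. -/
theorem exists_D_of_D_colimit (hC : ∀ S ∈ I, S.IsExclusive) {a b : Act}
    (h : (colimit I).depGraph.D a b) : ∃ i : Points I, i.1.depGraph.D a b := by
  classical
  obtain ⟨ha, hb, h⟩ := h
  obtain ⟨⟨i, hi⟩, hai⟩ := Set.mem_iUnion.1 ha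
  by_cases hab : a = b
  · subst hab
    exact ⟨⟨i, hi⟩, hai, hai, Or.inl rfl⟩
  obtain ⟨-, h⟩ := h.resolve_left hab
  by_contra hno
  have := h (fun c => decide (c = a ∨ c = b)) fun e he => by
    obtain ⟨⟨S, hS⟩, heS⟩ := Set.mem_iUnion.1 he
    obtain ⟨E, hE, hSE⟩ := hC S hS
    have heS : e ∈ S.C := heS
    rw [hSE] at heS
    refine heS.2 _ ?_
    rintro _ ⟨⟨c, d⟩, hcd, rfl⟩
    obtain ⟨hc, hd, hne⟩ := hE _ hcd
    have hcon : S.depGraph.D c d := by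
      refine ⟨hc, hd, Or.inr ?_⟩
      rw [hSE]
      exact ⟨⟨Set.union_subset (Set.singleton_subset_iff.2 hc) (Set.singleton_subset_iff.2 hd),
        Set.empty_subset _⟩, fun f hf => hf _ ⟨_, hcd, rfl⟩⟩
    have : ¬ ((c = a ∨ c = b) ∧ (d = a ∨ d = b)) := by
      rintro ⟨rfl | rfl, rfl | rfl⟩
      -- The cases in which `{c, d} = {a, b}` are excluded by `hno`.
      exacts [hne rfl, hno ⟨⟨S, hS⟩, hcon⟩, hno ⟨⟨S, hS⟩, S.depGraph.D_symm hcon⟩, hne rfl]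
    simpa [BoolEqn.Holds, BoolEqn.conflict, BTerm.eval] using this
  simp [BoolEqn.Holds, BoolEqn.conflict, BTerm.eval] at this

theorem restr_projTo {i j : Points I} (h : i.1.IsTC j.1) (m : (colimit I).depGraph.TraceMonoid) :
    restr h (projTo j m) = projTo i m :=
  DepGraph.proj_proj _ _ _ m

theorem projTo_surjective (i : Points I) : Function.Surjective (projTo i) :=
  DepGraph.proj_surjective _

theorem restr_restr {i j k : Points I} (h : i.1.IsTC j.1) (h' : j.1.IsTC k.1)
    (x : Traces I k) : restr h (restr h' x) = restr (h.trans h') x :=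
  DepGraph.proj_proj _ _ _ x

theorem restr_refl {i : Points I} (h : i.1.IsTC i.1) (x : Traces I i) : restr h x = x := by
  obtain ⟨m, rfl⟩ := projTo_surjective i x
  exact restr_projTo h m

/-! ### The sheaf space of traces -/

/-- The smallest open neighbourhood of a point. -/
def below (j : Points I) : Opens (Points I) :=
  ⟨{i | i.1.IsTC j.1}, fun _ _ h hi => h.trans hi⟩

theorem mem_below_self (j : Points I) : j ∈ below j := IsTC.refl j.1

/-- The topology on `∐ M(Sᵢ)` is the Alexandrov topology of restriction: a set is open if it is
closed under restricting traces to subsystems. -/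
theorem isOpen_traces_iff {W : Set (Σ i : Points I, Traces I i)} :
    IsOpen W ↔ ∀ (i j : Points I) (h : i.1.IsTC j.1) (x : Traces I j),
      (⟨j, x⟩ : Σ i : Points I, Traces I i) ∈ W →
        (⟨i, restr h x⟩ : Σ i : Points I, Traces I i) ∈ W := by
  constructor
  · intro hW
    induction hW with
    | basic W hW =>
      obtain ⟨m, U, hU, rfl⟩ := hW
      rintro i j h x ⟨hj, hx⟩
      have hx : x = projTo j m := hx
      exact ⟨hU i j h hj, by rw [hx, restr_projTo]⟩
    | univ => exact fun _ _ _ _ _ => trivial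
    | inter _ _ _ _ ih₁ ih₂ => exact fun i j h x hx => ⟨ih₁ i j h x hx.1, ih₂ i j h x hx.2⟩
    | sUnion _ _ ih => exact fun i j h x ⟨W, hW, hx⟩ => ⟨W, hW, ih W hW i j h x hx⟩
  · intro h
    have : W = ⋃ y : W, basicSet (projTo_surjective y.1.1 y.1.2).choose (below y.1.1 : Set _) := by
      ext ⟨i, x⟩
      simp only [Set.mem_iUnion]
      constructor
      · exact fun hx => ⟨⟨_, hx⟩, mem_below_self i,
          (projTo_surjective i x).choose_spec.symm⟩
      · rintro ⟨⟨⟨j, y⟩, hy⟩, hij, hx⟩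
        have hij : i.1.IsTC j.1 := hij
        have hx : x = _ := hx
        rw [hx, ← restr_projTo hij, (projTo_surjective j y).choose_spec]
        exact h i j hij y hy
    rw [this]
    exact isOpen_iUnion fun y =>
      .basic _ ⟨_, _, (below y.1.1).isOpen, rfl⟩

/-- The restrictions of a trace, its smallest neighbourhood. -/
def restrictions (y : Σ i : Points I, Traces I i) : Set (Σ i : Points I, Traces I i) :=
  {x | ∃ h : x.1.1.IsTC y.1.1, x.2 = restr h y.2}

theorem isOpen_restrictions (y : Σ i : Points I, Traces I i) : IsOpen (restrictions y) := by
  refine isOpen_traces_iff.2 ?_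
  rintro i j h x ⟨h', hx⟩
  have hx : x = restr h' y.2 := hx
  exact ⟨h.trans h', by rw [hx, restr_restr]⟩

theorem self_mem_restrictions (y : Σ i : Points I, Traces I i) : y ∈ restrictions y :=
  ⟨IsTC.refl _, (restr_refl _ _).symm⟩

theorem continuous_section_iff {s : ∀ i : Points I, Traces I i} :
    Continuous (fun i => ⟨i, s i⟩ : Points I → Σ i, Traces I i) ↔
      ∀ (i j : Points I) (h : i.1.IsTC j.1), restr h (s j) = s i := by
  constructor
  · intro hs i j h
    obtain ⟨_, hx⟩ := (isOpen_restrictions ⟨j, s j⟩).preimage hs i j h (self_mem_restrictions _)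
    exact hx.symm
  · refine fun hs => continuous_def.2 fun W hW i j h hj => ?_
    have := isOpen_traces_iff.1 hW i j h (s j) hj
    rwa [hs i j h] at this

theorem isSheafSpaceOfMonoids_traces (I : Set (System M vs Act)) :
    IsSheafSpaceOfMonoids (Traces I) where
  isLocalHomeomorph := by
    have hcont : Continuous (Sigma.fst : (Σ i, Traces I i) → Points I) :=
      continuous_def.2 fun U hU => isOpen_traces_iff.2 fun i j h _ hj => hU i j h hj
    have hopen : IsOpenMap (Sigma.fst : (Σ i, Traces I i) → Points I) := by
      rintro W hW i j h ⟨⟨_, x⟩, hx, rfl⟩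
      exact ⟨⟨i, restr h x⟩, isOpen_traces_iff.1 hW i _ h x hx, rfl⟩
    refine isLocalHomeomorph_iff_isOpenEmbedding_restrict.2 fun y => ?_
    refine ⟨restrictions y, (isOpen_restrictions y).mem_nhds (self_mem_restrictions y), ?_⟩
    refine .of_continuous_injective_isOpenMap (hcont.comp continuous_subtype_val) ?_
      (hopen.comp (isOpen_restrictions y).isOpenMap_subtype_val)
    rintro ⟨⟨i, x⟩, h, hx⟩ ⟨⟨j, z⟩, h', hz⟩ (hij : i = j)
    subst hij
    have hx : x = restr h y.2 := hx
    have hz : z = restr h' y.2 := hz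
    exact Subtype.ext (congrArg (Sigma.mk i) (hx.trans hz.symm))
  continuous_one := continuous_section_iff.2 fun i j h => map_one _
  continuous_mul := by
    let _ := fibreProductTopology (Traces I)
    refine continuous_def.2 fun W hW => isOpen_iff_mem_nhds.2 ?_
    rintro ⟨j, y, z⟩ hyz
    have hN : IsOpen ((fun q : Σ i, Traces I i × Traces I i =>
        (((⟨q.1, q.2.1⟩, ⟨q.1, q.2.2⟩) : (Σ i, Traces I i) × (Σ i, Traces I i)))) ⁻¹'
          (restrictions ⟨j, y⟩ ×ˢ restrictions ⟨j, z⟩)) :=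
      ((isOpen_restrictions _).prod (isOpen_restrictions _)).preimage continuous_induced_dom
    refine Filter.mem_of_superset
      (hN.mem_nhds ⟨self_mem_restrictions _, self_mem_restrictions _⟩) ?_
    rintro ⟨i, y', z'⟩ ⟨⟨hij, hy⟩, _, hz⟩
    have hij : i.1.IsTC j.1 := hij
    have hy : y' = restr hij y := hy
    have hz : z' = restr hij z := hz
    have := isOpen_traces_iff.1 hW i j hij _ hyz
    rw [map_mul, ← hy, ← hz] at this
    exact this

theorem coe_globalSections_traces (h : IsSheafSpaceOfMonoids (Traces I)) :
    (globalSections h : Set (∀ i, Traces I i)) =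
      {m | ∀ (i j : Points I) (hij : i.1.IsTC j.1), restr hij (m j) = m i} :=
  Set.ext fun _ => continuous_section_iff

theorem restr_section (h : IsSheafSpaceOfMonoids (Traces I)) {U : Opens (Points I)}
    (s : sectionsOver h U) {i j : Points I} (hij : i.1.IsTC j.1) (hj : j ∈ U) :
    restr hij (s.1 ⟨j, hj⟩) = s.1 ⟨i, U.isOpen i j hij hj⟩ := by
  have hW := U.isOpen.isOpenMap_subtype_val _
    ((isOpen_restrictions ⟨j, s.1 ⟨j, hj⟩⟩).preimage s.2)
  obtain ⟨⟨_, _⟩, ⟨_, hx⟩, rfl⟩ := hW i j hij ⟨⟨j, hj⟩, self_mem_restrictions _, rfl⟩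
  exact hx.symm

/-- Evaluation of germs at the point. -/
noncomputable def evalGerm (h : IsSheafSpaceOfMonoids (Traces I)) (i : Points I) :
    (sectionsPresheaf h).stalk i ⟶ MonCat.of (Traces I i) :=
  Limits.colimit.desc
    ((OpenNhds.inclusion (X := TopCat.of (Points I)) i).op ⋙ sectionsPresheaf h)
    { pt := MonCat.of (Traces I i)
      ι :=
        { app := fun U => MonCat.ofHom
            { toFun := fun s => s.1 ⟨i, U.unop.2⟩
              map_one' := rfl
              map_mul' := fun _ _ => rfl }
          naturality := fun _ _ _ => rfl } }

theorem evalGerm_germ (h : IsSheafSpaceOfMonoids (Traces I)) (i : Points I)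
    (U : Opens (Points I)) (hi : i ∈ U) (s : sectionsOver h U) :
    (evalGerm h i).hom (((sectionsPresheaf h).germ U i hi).hom s) = s.1 ⟨i, hi⟩ := by
  have : (sectionsPresheaf h).germ U i hi ≫ evalGerm h i = MonCat.ofHom
            { toFun := fun s => s.1 ⟨i, hi⟩
              map_one' := rfl
              map_mul' := fun _ _ => rfl } :=
    Limits.colimit.ι_desc (F := (OpenNhds.inclusion (X := TopCat.of (Points I)) i).op ⋙
      sectionsPresheaf h) _ (op ⟨U, hi⟩)
  exact congrArg (fun f => f.hom s) this

theorem evalGerm_bijective (h : IsSheafSpaceOfMonoids (Traces I)) (i : Points I) :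
    Function.Bijective (evalGerm h i).hom := by
  constructor
  · intro x y hxy
    obtain ⟨U, hU, s, rfl⟩ := (sectionsPresheaf h).exists_germ_eq x
    obtain ⟨W, hW, t, rfl⟩ := (sectionsPresheaf h).exists_germ_eq y
    have hxy : s.1 ⟨i, hU⟩ = t.1 ⟨i, hW⟩ :=
      (evalGerm_germ h i U hU s).symm.trans (hxy.trans (evalGerm_germ h i W hW t))
    have hle : ∀ {U : Opens (Points I)}, i ∈ U → below i ≤ U :=
      fun {U} hU j hj => U.isOpen j i hj hU
    refine (sectionsPresheaf h).germ_ext (below i) (mem_below_self i) (homOfLE (hle hU))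
      (homOfLE (hle hW)) (Subtype.ext (funext fun j => ?_))
    exact (restr_section h s j.2 hU).symm.trans
      ((congrArg _ hxy).trans (restr_section h t j.2 hW))
  · intro x
    obtain ⟨m, rfl⟩ := projTo_surjective i x
    refine ⟨((sectionsPresheaf h).germ ⊤ i trivial).hom
      ⟨fun j => projTo j.1 m, ?_⟩, evalGerm_germ h i ⊤ trivial _⟩
    exact (continuous_section_iff.2 fun i j hij => restr_projTo hij m).comp
      continuous_subtype_val

end System

/-! ### Shortest cycles of a relation -/

/-- If every element of a finite nonempty type is related to some element, then the relation has a
cycle. In a shortest one, vertices are distinct and related only if they are consecutive. -/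
theorem exists_shortest_cycle {α : Type*} [Finite α] [Nonempty α] {R : α → α → Prop}
    (hR : ∀ a, ∃ b, R a b) :
    ∃ (n : ℕ) (c : ℕ → α), 0 < n ∧ c n = c 0 ∧ (∀ k < n, R (c k) (c (k + 1))) ∧
      ∀ p q, p < q → q < n → c p ≠ c q ∧ (R (c p) (c q) → q = p + 1) ∧
        (R (c q) (c p) → p = 0 ∧ q + 1 = n) := by
  classical
  have hex : ∃ n, 0 < n ∧ ∃ c : ℕ → α, c n = c 0 ∧ ∀ k < n, R (c k) (c (k + 1)) := by
    choose f hf using hR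
    obtain ⟨p, q, hpq, h⟩ := Finite.exists_ne_map_eq_of_infinite
      fun k : ℕ => f^[k] (Classical.arbitrary α)
    wlog hlt : p < q generalizing p q
    · exact this q p hpq.symm h.symm (by omega)
    refine ⟨q - p, by omega, fun k => f^[p + k] (Classical.arbitrary α), ?_, fun k _ => ?_⟩
    · simpa [Nat.add_sub_cancel' hlt.le] using h.symm
    · simp only [← add_assoc, Function.iterate_succ_apply']
      exact hf _
  obtain ⟨hn, c, hc0, hc⟩ := Nat.find_spec hex
  set n := Nat.find hex
  have hmin : ∀ m, 0 < m → (∃ c : ℕ → α, c m = c 0 ∧ ∀ k < m, R (c k) (c (k + 1))) → n ≤ m :=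
    fun m hm h => Nat.find_min' hex ⟨hm, h⟩
  -- A coincidence or a relation between nonconsecutive vertices yields a shorter cycle: drop the
  -- part between `p` and `q`, or keep only that part.
  refine ⟨n, c, hn, hc0, hc, fun p q hpq hqn => ⟨fun h => ?_, fun h => ?_, fun h => ?_⟩⟩
  · have := hmin (q - p) (by omega) ⟨fun k => c (p + k), by
      simp only [Nat.add_sub_cancel' hpq.le, add_zero, h], fun k hk => hc _ (by omega)⟩
    omega
  · have := hmin (p + 1 + (n - q)) (by omega)
      ⟨fun k => if k ≤ p then c k else c (q + (k - p - 1)), ?_, fun k hk => ?_⟩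
    · omega
    · simp only [zero_le, if_true]
      rw [if_neg (by omega), ← hc0]
      congr 1
      omega
    · rcases lt_trichotomy k p with hkp | rfl | hkp
      · simp only [hkp.le, Nat.succ_le_of_lt hkp, if_true]
        exact hc k (by omega)
      · simpa using h
      · simp only [not_le.2 hkp, not_le.2 (Nat.lt_succ_of_lt hkp), if_false]
        convert hc (q + (k - p - 1)) (by omega) using 2
        omega
  · have := hmin (q - p + 1) (by omega)
      ⟨fun k => if k ≤ q - p then c (p + k) else c p, by simp, fun k hk => ?_⟩
    · omega
    · rcases (Nat.lt_succ_iff.1 hk).lt_or_eq with hk | rfl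
      · simp only [hk.le, Nat.succ_le_of_lt hk, if_true, ← add_assoc]
        exact hc _ (by omega)
      · simpa [Nat.add_sub_cancel' hpq.le] using h

theorem cycleGraph_adj_iff {n : ℕ} {k l : Fin (n + 2)} :
    (SimpleGraph.cycleGraph (n + 2)).Adj k l ↔ l = k + 1 ∨ k = l + 1 := by
  rw [SimpleGraph.cycleGraph_adj, sub_eq_iff_eq_add', sub_eq_iff_eq_add', or_comm]

theorem fin_add_one_ne_self {n : ℕ} (k : Fin (n + 2)) : k + 1 ≠ k := by
  simp

namespace System

open DepGraph

variable {Sg : Signature.{u}} {M : Sg.Structure} {V : Type u} {vs : V → Sg.Srt} {Act : Type u}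
  {I : Set (System M vs Act)} {T : System M vs Act}

/-! ### Gluing compatible families of traces -/

/-- A family of traces that is compatible with restriction to subsystems. -/
def Compatible (m : ∀ i : Points I, Traces I i) : Prop :=
  ∀ (i j : Points I) (hij : i.1.IsTC j.1), restr hij (m j) = m i

/-- Two members of a compatible family have the same projection to a pair of letters that is
dependent in both systems, since it is dependent in the pullback. -/
theorem Compatible.pairProj_eq (hI : IsInteracting T I) {m : ∀ i : Points I, Traces I i}
    (hm : Compatible m) {i j : Points I} {a b : Act} (hi : i.1.depGraph.D a b)
    (hj : j.1.depGraph.D a b) : pairProj hi (m i) = pairProj hj (m j) := by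
  let k : Points I := ⟨i.1.pullback j.1, hI.pullback_mem _ i.2 _ j.2⟩
  have hki : k.1.IsTC i.1 := hI.pullback_left _ i.2 _ j.2
  have hkj : k.1.IsTC j.1 := hI.pullback_right _ i.2 _ j.2
  have hk : k.1.depGraph.D a b := D_pullback hi hj
  rw [← pairProj_proj hki.depGraph_isSub hk, ← pairProj_proj hkj.depGraph_isSub hk]
  exact congrArg _ ((hm k i hki).trans (hm k j hkj).symm)

/-- The letter `a` occurs in some member of the family. -/
def Occurs (m : ∀ i : Points I, Traces I i) (a : Act) : Prop :=
  ∃ (i : Points I) (h : i.1.depGraph.D a a), a ∈ (pairProj h (m i)).toList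

/-- The letters `a` and `b` are dependent in some system of the family, and there the first of
their occurrences is one of `b`. -/
def Blocks (m : ∀ i : Points I, Traces I i) (a b : Act) : Prop :=
  a ≠ b ∧ ∃ (i : Points I) (h : i.1.depGraph.D a b), (pairProj h (m i)).toList.head? = some b

theorem mem_pairProj_of_mem {G : DepGraph Act} {a b c : Act} (hab : G.D a b) (hac : G.D a c)
    {x : G.TraceMonoid} (h : a ∈ (pairProj hab x).toList) : a ∈ (pairProj hac x).toList := by
  obtain ⟨w, rfl⟩ := ofWord_surjective x
  exact (mem_pairProj (a := ⟨a, G.D_left hac⟩) hac).2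
    ((mem_pairProj (a := ⟨a, G.D_left hac⟩) hab).1 h)

theorem pairProj_symm {G : DepGraph Act} {a b : Act} (hab : G.D a b) (x : G.TraceMonoid) :
    pairProj (G.D_symm hab) x = pairProj hab x := by
  obtain ⟨w, rfl⟩ := ofWord_surjective x
  classical
  apply FreeMonoid.toList.injective
  simp only [pairProj_ofWord, toList_pairWord, or_comm]

theorem eq_or_eq_of_mem_pairProj {G : DepGraph Act} {a b c : Act} (hab : G.D a b)
    {x : G.TraceMonoid} (h : c ∈ (pairProj hab x).toList) : c = a ∨ c = b := by
  classical
  obtain ⟨w, rfl⟩ := ofWord_surjective x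
  rw [pairProj_ofWord, toList_pairWord] at h
  simpa using (List.mem_filter.1 h).2

theorem Compatible.head_or_head (hI : IsInteracting T I) {m : ∀ i : Points I, Traces I i}
    (hm : Compatible m) {a b : Act} (ha : Occurs m a) {i : Points I} (hab : i.1.depGraph.D a b) :
    (pairProj hab (m i)).toList.head? = some a ∨ (pairProj hab (m i)).toList.head? = some b := by
  obtain ⟨j, hj, haj⟩ := ha
  have haa : i.1.depGraph.D a a := i.1.depGraph.D_refl (i.1.depGraph.D_left hab)
  rw [hm.pairProj_eq hI hj haa] at haj
  have hne := List.ne_nil_of_mem (mem_pairProj_of_mem haa hab haj)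
  rw [List.head?_eq_some_head hne, Option.some_inj, Option.some_inj]
  exact eq_or_eq_of_mem_pairProj hab (List.head_mem hne)

theorem Blocks.occurs {m : ∀ i : Points I, Traces I i} {a b : Act} (h : Blocks m a b) :
    Occurs m b := by
  obtain ⟨-, i, hab, h⟩ := h
  have hbb := i.1.depGraph.D_refl (D_right hab)
  refine ⟨i, hbb, mem_pairProj_of_mem (i.1.depGraph.D_symm hab) hbb ?_⟩
  rw [pairProj_symm hab]
  exact List.mem_of_mem_head? h

theorem finite_occurs (hfin : I.Finite) (m : ∀ i : Points I, Traces I i) :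
    {a | Occurs m a}.Finite := by
  have : Finite (Points I) := hfin
  choose w hw using fun i => ofWord_surjective (m i)
  refine (Set.finite_iUnion fun i => ((w i).toList.map Subtype.val).finite_toSet).subset ?_
  rintro a ⟨i, h, ha⟩
  rw [← hw, mem_pairProj (a := ⟨a, i.1.depGraph.D_left h⟩)] at ha
  exact Set.mem_iUnion.2 ⟨i, List.mem_map_of_mem (f := Subtype.val) ha⟩

/-- If every chordless cycle lies in a member of the family, then in a nontrivial compatible family
some letter comes first in all members that contain it. Otherwise every letter is blocked by
another, and a shortest cycle of blocked letters is chordless, since of two dependent letters one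
blocks the other. So it lies in a member of the family, and no letter of the cycle can be the first
one to occur there. -/
theorem Compatible.exists_leading_letter (hI : IsInteracting T I) (hC : ∀ S ∈ I, S.IsExclusive)
    (hfin : I.Finite)
    (hcyc : ∀ n : ℕ, 2 ≤ n → ∀ c : (colimit I).depGraph.ChordlessCycle n,
      ∃ S ∈ I, S.depGraph.IsCycleIn fun k => c.1 k)
    {m : ∀ i : Points I, Traces I i} (hm : Compatible m) (hne : ∃ a, Occurs m a) :
    ∃ a, Occurs m a ∧ ∀ (i : Points I) (b : Act) (h : i.1.depGraph.D a b),
      (pairProj h (m i)).toList.head? = some a := by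
  by_contra hno
  push Not at hno
  have : Finite {a // Occurs m a} := finite_occurs hfin m
  have : Nonempty {a // Occurs m a} := nonempty_subtype.2 hne
  obtain ⟨n, c, hn, hc0, hc, hmin⟩ :=
    exists_shortest_cycle (α := {a // Occurs m a}) (R := fun a b => Blocks m a.1 b.1) <| by
      rintro ⟨a, ha⟩
      obtain ⟨i, b, hab, hh⟩ := hno a ha
      have hb := (hm.head_or_head hI ha hab).resolve_left hh
      have hbl : Blocks m a b := ⟨by rintro rfl; exact hh hb, i, hab, hb⟩
      exact ⟨⟨b, hbl.occurs⟩, hbl⟩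
  obtain ⟨n, rfl⟩ : ∃ k, n = k + 2 := by
    refine ⟨n - 2, ?_⟩
    have : n ≠ 1 := by
      rintro rfl
      exact (hc 0 hn).1 (by rw [hc0])
    omega
  have hstep : ∀ k : Fin (n + 2), Blocks m (c k) (c (k + 1 : Fin (n + 2))) := by
    intro k
    by_cases hk : k = Fin.last _
    · have := hc (n + 1) (by omega)
      rw [hc0] at this
      rw [hk, Fin.last_add_one]
      exact this
    · rw [Fin.val_add_one_of_lt (Fin.lt_last_iff_ne_last.2 hk)]
      exact hc k k.2
  have hDstep : ∀ k : Fin (n + 2), (colimit I).depGraph.D (c k) (c (k + 1 : Fin (n + 2))) := by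
    intro k
    obtain ⟨-, i, h, -⟩ := hstep k
    exact (depGraph_isSub_colimit i.2).2 _ _ h
  have hlt : ∀ k l : Fin (n + 2), k < l → (colimit I).depGraph.D (c k) (c l) →
      l = k + 1 ∨ k = l + 1 := by
    intro k l hkl hD
    obtain ⟨hne, h₁, h₂⟩ := hmin k l hkl l.2
    obtain ⟨i, hi⟩ := exists_D_of_D_colimit hC hD
    rcases hm.head_or_head hI (c k).2 hi with h | h
    · obtain ⟨hk, hl⟩ := h₂ ⟨fun e => hne (Subtype.ext e.symm), i, i.1.depGraph.D_symm hi, by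
        rwa [pairProj_symm]⟩
      right
      have : l = Fin.last _ := Fin.ext (by simp; omega)
      rw [this, Fin.last_add_one]
      exact Fin.ext hk
    · left
      have hl := h₁ ⟨fun e => hne (Subtype.ext e), i, hi, h⟩
      refine Fin.ext ?_
      rw [Fin.val_add_one_of_lt (lt_of_lt_of_le hkl (Fin.le_last l))]
      exact hl
  have hinj : Function.Injective fun k : Fin (n + 2) => (c k : Act) := by
    intro k l hkl
    have hkl : c k = c l := Subtype.ext hkl
    by_contra h
    rcases lt_or_gt_of_ne h with h | h
    · exact (hmin k l h l.2).1 hkl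
    · exact (hmin l k h k.2).1 hkl.symm
  have hadj : ∀ k l : Fin (n + 2), (colimit I).depGraph.toSimpleGraph.Adj (c k) (c l) ↔
      (SimpleGraph.cycleGraph (n + 2)).Adj k l := by
    intro k l
    rw [cycleGraph_adj_iff]
    constructor
    · rintro ⟨hne, hD⟩
      rcases lt_trichotomy k l with h | rfl | h
      · exact hlt k l h hD
      · exact absurd rfl hne
      · exact (hlt l k h ((colimit I).depGraph.D_symm hD)).symm
    · rintro (rfl | rfl)
      · exact ⟨fun h => fin_add_one_ne_self k (hinj h.symm), hDstep k⟩
      · exact ⟨fun h => fin_add_one_ne_self l (hinj h),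
          (colimit I).depGraph.D_symm (hDstep l)⟩
  obtain ⟨S, hS, -, -, hSadj⟩ := hcyc (n + 2) (by omega)
    ⟨⟨⟨fun k => c k, hinj⟩, hadj _ _⟩, fun k => (colimit I).depGraph.D_left (hDstep k)⟩
  have hD : ∀ k : Fin (n + 2), S.depGraph.D (c k) (c (k + 1 : Fin (n + 2))) := fun k =>
    (hSadj k (k + 1) (cycleGraph_adj_iff.2 (Or.inl rfl))).2
  refine not_forall_head? (fun k : Fin (n + 2) => (c k : Act)) (fun k => k + 1)
    (fun k h => fin_add_one_ne_self k (hinj h)) hD (m ⟨S, hS⟩) fun k => ?_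
  obtain ⟨-, j, hj, h⟩ := hstep k
  rw [← h, hm.pairProj_eq hI hj (j := ⟨S, hS⟩) (hD k)]

theorem projTo_of_mem {i : Points I} {a : (colimit I).depGraph.verts} (ha : a.1 ∈ i.1.A) :
    projTo i ((colimit I).depGraph.ofWord (FreeMonoid.of a)) =
      i.1.depGraph.ofWord (FreeMonoid.of ⟨a.1, ha⟩) :=
  erase_of_mem (G := i.1.depGraph) ha

theorem projTo_of_notMem {i : Points I} {a : (colimit I).depGraph.verts} (ha : a.1 ∉ i.1.A) :
    projTo i ((colimit I).depGraph.ofWord (FreeMonoid.of a)) = 1 :=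
  erase_of_notMem (G := i.1.depGraph) ha

theorem Compatible.exists_projTo_eq (hI : IsInteracting T I) (hC : ∀ S ∈ I, S.IsExclusive)
    (hfin : I.Finite)
    (hcyc : ∀ n : ℕ, 2 ≤ n → ∀ c : (colimit I).depGraph.ChordlessCycle n,
      ∃ S ∈ I, S.depGraph.IsCycleIn fun k => c.1 k)
    {m : ∀ i : Points I, Traces I i} (hm : Compatible m) :
    ∃ x, ∀ i, projTo i x = m i := by
  have : Finite (Points I) := hfin
  let _ : Fintype (Points I) := Fintype.ofFinite _
  -- The total length drops when a leading letter is split off from all members that contain it.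
  induction hN : ∑ i : Points I, (i.1.depGraph.traceLength (m i)).toAdd
    using Nat.strong_induction_on generalizing m with
  | _ N ih =>
  by_cases hne : ∃ a, Occurs m a
  · obtain ⟨a, ⟨i₀, hi₀, -⟩, ha⟩ := hm.exists_leading_letter hI hC hfin hcyc hne
    have haA : a ∈ (colimit I).depGraph.verts := (depGraph_isSub_colimit i₀.2).1 hi₀.1
    set g := (colimit I).depGraph.ofWord (FreeMonoid.of ⟨a, haA⟩) with hg
    have hy : ∀ i, ∃ y, m i = projTo i g * y := by
      intro i
      by_cases hai : a ∈ i.1.A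
      · rw [hg, projTo_of_mem hai]
        exact exists_eq_of_mul fun b hab => ha i b hab
      · rw [hg, projTo_of_notMem hai]
        exact ⟨m i, (one_mul _).symm⟩
    choose y hy using hy
    have hyc : Compatible y := by
      intro i j hij
      have := hm i j hij
      rw [hy i, hy j, map_mul, restr_projTo] at this
      exact trace_mul_left_cancel this
    obtain ⟨x, hx⟩ := ih _ (by
      rw [← hN]
      refine Finset.sum_lt_sum (fun (i : Points I) _ => ?_) ⟨i₀, Finset.mem_univ _, ?_⟩
      · rw [hy i, map_mul, toAdd_mul]
        exact Nat.le_add_left _ _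
      · rw [hy i₀, map_mul, toAdd_mul, hg, projTo_of_mem (i := i₀) hi₀.1]
        exact Nat.lt_add_of_pos_left Nat.one_pos) hyc rfl
    exact ⟨g * x, fun i => by rw [map_mul, hx, hy]⟩
  · refine ⟨1, fun i => ?_⟩
    rw [map_one]
    obtain ⟨w, hw⟩ := ofWord_surjective (m i)
    have : w.toList = [] := by
      refine List.eq_nil_iff_forall_not_mem.2 fun a ha => hne ⟨a, i, i.1.depGraph.D_refl a.2, ?_⟩
      rw [← hw]
      exact (mem_pairProj _).2 ha
    rw [← hw, show w = 1 from this, map_one]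

/-! ### A chordless cycle outside all members gives a family that does not glue -/

theorem filter_eq_pair {l : List Act} (hl : l.Nodup) {a b : Act} (h : [a, b].Sublist l)
    [DecidablePred fun x => x = a ∨ x = b] : l.filter (fun x => x = a ∨ x = b) = [a, b] := by
  have hsub := h.filter fun x => decide (x = a ∨ x = b)
  rw [List.filter_eq_self.2 (by simp)] at hsub
  refine (hsub.eq_of_length_le ((hl.filter _).subperm fun x hx => ?_).length_le).symm
  simpa using (List.mem_filter.1 hx).2

theorem eq_of_perm_of_forall_eq {α : Type*} {l₁ l₂ : List α} (h : l₁.Perm l₂) {a : α}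
    (h₁ : ∀ b ∈ l₁, b = a) : l₁ = l₂ := by
  rw [List.eq_replicate_of_mem h₁,
    List.eq_replicate_of_mem (l := l₂) fun b hb => h₁ b (h.mem_iff.2 hb), h.length_eq]

theorem pair_sublist_ofFn {α : Type*} {n : ℕ} (f : Fin n → α) {k l : Fin n} (h : k < l) :
    [f k, f l].Sublist (List.ofFn f) := by
  have : [k, l].Sublist (List.finRange n) :=
    List.sublist_of_subperm_of_pairwise (r := (· < ·))
      (List.Nodup.subperm (by simp [h.ne]) fun _ _ => List.mem_finRange _)
      (by simp [h]) (List.pairwise_lt_finRange n)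
  rw [List.ofFn_eq_map]
  exact this.map f

section Rotation

variable {G : DepGraph Act} {n : ℕ} (c : G.ChordlessCycle (n + 2))

/-- The word that runs once around the cycle `c` and ends with `c j`. -/
def rotation (j : Fin (n + 2)) : FreeMonoid G.verts :=
  FreeMonoid.ofList (List.ofFn fun t => ⟨c.1 (j + 1 + t), c.2 _⟩)

theorem map_rotation (j : Fin (n + 2)) :
    (rotation c j).toList.map Subtype.val = List.ofFn fun t => c.1 (j + 1 + t) := by
  rw [rotation, FreeMonoid.toList_ofList, List.map_ofFn]
  rfl

theorem chordlessCycle_D (k : Fin (n + 2)) : G.D (c.1 k) (c.1 (k + 1)) :=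
  (c.1.map_rel_iff.2 (cycleGraph_adj_iff.2 (Or.inl rfl)) :
    G.toSimpleGraph.Adj (c.1 k) (c.1 (k + 1))).2

/-- In the rotation that ends with `c j`, the letter `c k` precedes `c (k + 1)` unless `k = j`. -/
theorem pairProj_rotation {j k : Fin (n + 2)} (hkj : k ≠ j)
    (hD : G.D (c.1 k) (c.1 (k + 1))) :
    (pairProj hD (G.ofWord (rotation c j))).toList = [c.1 k, c.1 (k + 1)] := by
  classical
  rw [pairProj_ofWord, toList_pairWord, map_rotation]
  refine filter_eq_pair (List.nodup_ofFn.2 (c.1.injective.comp (add_right_injective (j + 1)))) ?_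
  -- `c k` stands at position `k - j - 1`, which is the last one only for `k = j`.
  have hlt : k - j - 1 < k - j - 1 + 1 := by
    refine Fin.lt_add_one_iff.2 (Fin.lt_last_iff_ne_last.2 fun h => hkj ?_)
    have : k - j - 1 + 1 = 0 := by rw [h, Fin.last_add_one]
    rwa [sub_add_cancel, sub_eq_zero] at this
  have h := pair_sublist_ofFn (fun t => c.1 (j + 1 + t)) hlt
  rwa [show j + 1 + (k - j - 1) = k by abel, show j + 1 + (k - j - 1 + 1) = k + 1 by abel] at h

theorem rotation_perm (j k : Fin (n + 2)) :
    (List.ofFn fun t => c.1 (j + 1 + t)).Perm (List.ofFn fun t => c.1 (k + 1 + t)) := by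
  have h (j : Fin (n + 2)) :
      (List.ofFn fun t => c.1 (j + 1 + t)).Perm (List.ofFn fun t => c.1 t) := by
    simpa only [Function.comp_def, Equiv.coe_addLeft] using
      Equiv.Perm.ofFn_comp_perm (Equiv.addLeft (j + 1)) fun t => c.1 t
  exact (h j).trans (h k).symm

/-- Two rotations have the same projection to a pair of letters unless it is the pair at which one
of them breaks the cycle. -/
theorem pairProj_rotation_eq {j k : Fin (n + 2)} {a b : Act} (hD : G.D a b)
    (hbreak : ∀ l, (a = c.1 l ∧ b = c.1 (l + 1)) ∨ (b = c.1 l ∧ a = c.1 (l + 1)) →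
      l ≠ j ∧ l ≠ k) :
    pairProj hD (G.ofWord (rotation c j)) = pairProj hD (G.ofWord (rotation c k)) := by
  classical
  apply FreeMonoid.toList.injective
  by_cases h : a ≠ b ∧ (∃ p, c.1 p = a) ∧ ∃ q, c.1 q = b
  · obtain ⟨hne, ⟨p, rfl⟩, q, rfl⟩ := h
    rcases cycleGraph_adj_iff.1 (c.1.map_rel_iff.1 (show G.toSimpleGraph.Adj _ _ from ⟨hne, hD⟩))
      with rfl | rfl
    · obtain ⟨hj, hk⟩ := hbreak p (Or.inl ⟨rfl, rfl⟩)
      rw [pairProj_rotation c hj, pairProj_rotation c hk]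
    · obtain ⟨hj, hk⟩ := hbreak q (Or.inr ⟨rfl, rfl⟩)
      have hD' := G.D_symm hD
      rw [← pairProj_symm hD, ← pairProj_symm hD, pairProj_rotation c hj,
        pairProj_rotation c hk]
  · simp only [pairProj_ofWord, toList_pairWord, map_rotation]
    have hp := (rotation_perm c j k).filter fun x => decide (x = a ∨ x = b)
    by_cases ha : ∃ p, c.1 p = a
    · refine eq_of_perm_of_forall_eq hp (a := a) fun x hx => ?_
      simp only [List.mem_filter, List.mem_ofFn, decide_eq_true_eq] at hx
      obtain ⟨⟨t, rfl⟩, hx | hx⟩ := hx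
      · exact hx
      · by_contra hxa
        exact h ⟨fun e => hxa (hx.trans e.symm), ha, _, hx⟩
    · refine eq_of_perm_of_forall_eq hp (a := b) fun x hx => ?_
      simp only [List.mem_filter, List.mem_ofFn, decide_eq_true_eq] at hx
      obtain ⟨⟨t, rfl⟩, hx | hx⟩ := hx
      · exact absurd ⟨_, hx⟩ ha
      · exact hx

end Rotation

/-- If a chordless cycle is not contained in any member of the family, then each member misses one
of its edges, and the rotations of the cycle that start after a missing edge form a compatible
family. A trace that induces this family would have each vertex of the cycle before its successor. -/
theorem exists_isCycleIn_of_forall_exists (hC : ∀ S ∈ I, S.IsExclusive)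
    (hsurj : ∀ m : ∀ i : Points I, Traces I i, Compatible m → ∃ x, ∀ i, projTo i x = m i)
    {n : ℕ} (c : (colimit I).depGraph.ChordlessCycle (n + 2)) :
    ∃ S ∈ I, S.depGraph.IsCycleIn fun k => c.1 k := by
  by_contra hno
  have hmiss : ∀ i : Points I, ∃ k : Fin (n + 2), ¬ i.1.depGraph.D (c.1 k) (c.1 (k + 1)) := by
    intro i
    by_contra hall
    push Not at hall
    refine hno ⟨i.1, i.2, c.1.injective, fun k => i.1.depGraph.D_left (hall k), fun k l h => ?_⟩
    refine ⟨fun e => h.ne (c.1.injective e), ?_⟩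
    rcases cycleGraph_adj_iff.1 h with rfl | rfl
    · exact hall k
    · exact i.1.depGraph.D_symm (hall l)
  choose κ hκ using hmiss
  have hcomp : Compatible fun i : Points I =>
      projTo i ((colimit I).depGraph.ofWord (rotation c (κ i))) := by
    intro i j hij
    rw [restr_projTo]
    refine ext_pairProj fun a b hab => ?_
    refine (pairProj_proj (depGraph_isSub_colimit i.2) hab _).trans
      (Eq.trans ?_ (pairProj_proj (depGraph_isSub_colimit i.2) hab _).symm)
    refine pairProj_rotation_eq c _ fun l hl => ?_
    have hD : i.1.depGraph.D (c.1 l) (c.1 (l + 1)) := by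
      rcases hl with ⟨rfl, rfl⟩ | ⟨rfl, rfl⟩
      exacts [hab, i.1.depGraph.D_symm hab]
    refine ⟨?_, ?_⟩ <;> rintro rfl
    exacts [hκ j (hij.depGraph_isSub.2 _ _ hD), hκ i hD]
  obtain ⟨x, hx⟩ := hsurj _ hcomp
  have hhead : ∀ k, (pairProj (chordlessCycle_D c k) x).toList.head? = some (c.1 k) := by
    intro k
    obtain ⟨i, hi⟩ := exists_D_of_D_colimit hC (chordlessCycle_D c k)
    have h := congrArg (pairProj hi) (hx i)
    have h := (pairProj_proj (depGraph_isSub_colimit i.2) hi _).symm.trans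
      (h.trans (pairProj_proj (depGraph_isSub_colimit i.2) hi _))
    rw [h, pairProj_rotation c (by rintro rfl; exact hκ i hi)]
    rfl
  have hD : ∀ k, (colimit I).depGraph.D (c.1 k) (c.1 (k - 1)) := fun k =>
    (colimit I).depGraph.D_symm (by simpa using chordlessCycle_D c (k - 1))
  refine not_forall_head? (fun k => c.1 k) (fun k => k - 1) (fun k h => ?_) hD x fun k => ?_
  · exact fin_add_one_ne_self (k - 1) (by rw [sub_add_cancel]; exact (c.1.injective h).symm)
  · have h := hhead (k - 1)
    rw [← pairProj_symm] at h
    convert h using 5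
    simp

/-! ### Global sections and the weak product -/

theorem eq_of_projTo_eq (hC : ∀ S ∈ I, S.IsExclusive) {x y : (colimit I).depGraph.TraceMonoid}
    (h : ∀ i : Points I, projTo i x = projTo i y) : x = y := by
  refine ext_pairProj fun a b hab => ?_
  obtain ⟨i, hi⟩ := exists_D_of_D_colimit hC hab
  exact (pairProj_proj (depGraph_isSub_colimit i.2) hi x).symm.trans
    ((congrArg _ (h i)).trans (pairProj_proj (depGraph_isSub_colimit i.2) hi y))

theorem finite_projTo_ne_one (hA : ∀ a ∈ (colimit I).A, {S ∈ I | a ∈ S.A}.Finite)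
    (x : (colimit I).depGraph.TraceMonoid) : {i : Points I | projTo i x ≠ 1}.Finite := by
  obtain ⟨w, rfl⟩ := ofWord_surjective x
  induction w using FreeMonoid.inductionOn' with
  | one => simp
  | of_mul a w ih =>
    have ha : {i : Points I | a.1 ∈ i.1.A}.Finite :=
      ((hA a.1 a.2).preimage Subtype.val_injective.injOn).subset fun i hi => ⟨i.2, hi⟩
    refine (ha.union ih).subset fun i hi => ?_
    by_contra hno
    rw [Set.mem_union, not_or] at hno
    refine hi ?_
    rw [map_mul, map_mul, projTo_of_notMem hno.1, one_mul]
    exact not_not.1 hno.2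

end System

theorem theorem7 {Sg : Signature.{u}} (M : Sg.Structure) {V : Type u} (vs : V → Sg.Srt)
    {Act : Type u} (T : System M vs Act) (I : Set (System M vs Act))
    (hI : System.IsInteracting T I) (hC : ∀ S ∈ I, S.IsExclusive) :
    ∃ h : IsSheafSpaceOfMonoids (System.Traces I),
      -- the stalks
      (∀ i : System.Points I, ∃ e : (sectionsPresheaf h).stalk i ≃* System.Traces I i,
        ∀ (U : Opens (System.Points I)) (hi : i ∈ U) (s : sectionsOver h U),
          e (((sectionsPresheaf h).germ U i hi).hom s) = s.1 ⟨i, hi⟩) ∧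
      -- the global sections
      (globalSections h : Set (∀ i, System.Traces I i)) =
        {m | ∀ (i j : System.Points I) (hij : i.1.IsTC j.1), System.restr hij (m j) = m i} ∧
      -- finite families
      (∃ α : (System.colimit I).depGraph.TraceMonoid →* globalSections h,
        (∀ m i, (α m).1 i = System.projTo i m) ∧
        (I.Finite →
          (Function.Injective α ∧ ∀ i, Function.Surjective fun m => (α m).1 i) ∧
          (Function.Bijective α ↔
            ∀ n : ℕ, 2 ≤ n → ∀ c : (System.colimit I).depGraph.ChordlessCycle n,
              ∃ S ∈ I, S.depGraph.IsCycleIn fun k => c.1 k))) ∧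
      -- infinite families
      (I.Infinite → (∀ a ∈ (System.colimit I).A, {S ∈ I | a ∈ S.A}.Finite) →
        ∃ β : (System.colimit I).depGraph.TraceMonoid →* weakProduct (System.Traces I),
          (∀ m i, (β m).1 i = System.projTo i m) ∧ Function.Injective β) := by
  have h := System.isSheafSpaceOfMonoids_traces I
  refine ⟨h, fun i => ⟨MulEquiv.ofBijective (System.evalGerm h i).hom
    (System.evalGerm_bijective h i), System.evalGerm_germ h i⟩,
    System.coe_globalSections_traces h, ?_, fun _ hA => ?_⟩
  · let α : (System.colimit I).depGraph.TraceMonoid →* globalSections h :=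
      (MonoidHom.pi System.projTo).codRestrict (globalSections h) fun m =>
        System.continuous_section_iff.2 fun i j hij => System.restr_projTo hij m
    have hα : Function.Injective α := fun x y hxy => System.eq_of_projTo_eq hC fun i =>
      congrFun (congrArg Subtype.val hxy) i
    refine ⟨α, fun _ _ => rfl, fun hfin => ⟨⟨hα, System.projTo_surjective⟩, fun hbij => ?_,
      fun hcyc => ⟨hα, fun s => ?_⟩⟩⟩
    · intro n hn
      obtain ⟨n, rfl⟩ := Nat.exists_eq_add_of_le' hn
      refine System.exists_isCycleIn_of_forall_exists hC fun m hm => ?_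
      obtain ⟨x, hx⟩ := hbij.2 ⟨m, System.continuous_section_iff.2 hm⟩
      exact ⟨x, congrFun (congrArg Subtype.val hx)⟩
    · obtain ⟨x, hx⟩ := System.Compatible.exists_projTo_eq hI hC hfin hcyc
        (System.continuous_section_iff.1 s.2)
      exact ⟨x, Subtype.ext (funext hx)⟩
  · exact ⟨(MonoidHom.pi System.projTo).codRestrict (weakProduct (System.Traces I))
      (System.finite_projTo_ne_one hA), fun _ _ => rfl, fun x y hxy =>
      System.eq_of_projTo_eq hC (congrFun (congrArg Subtype.val hxy))⟩
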